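/- **Setting.** Let $h\ge 2$ and let $p_1,\dots,p_h$ be primes with $p_i\ne p_{i+1}$ for $1\le i<h$. The algebra $\mathbf D=\mathbf D[p_1,\dots,p_h]$ is the abelian group $\mathbb Z_{p_1}\times\dots\times\mathbb Z_{p_h}$ expanded by the unary operations $e_j(x)=(0,\dots,0,x_j,0,\dots,0)$ for $1\le j\le h$ and $v_j(x)=(0,\dots,0,b_j(x_{j+1}),0,\dots,0)$ for $1\le j<h$ (non-zero entry at position $j$), where $b_j(0)=0$ and $b_j(a)=1$ for $a\neq 0$. A circuit $\Gamma$ over $\mathbf D$ is built from input gates, constants from $D$ and the basic operations $+,-,e_j,v_j$, and has two designated output gates; $|\Gamma|$ is the number of its gates (input gates included). $\mathrm{Csat}(\mathbf D)$ asks whether some assignment of elements of $D$ to the input gates gives the two output gates the same value; $\mathrm{Ceqv}(\mathbf D)$ asks whether all assignments do. **SESH.** For a prime $q$ and $R\subseteq\mathbb Z_q$, a gate $\mathrm{MOD}_q^R$ (of unbounded fan-in, a wire may be plugged in several times) returns $1$ iff the sum of its Boolean inputs modulo $q$ lies in $R$. A $CC[p_1,\dots,p_h]$-circuit consists of $h$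 layers; the gates of the $i$-th layer are $\mathrm{MOD}_{p_i}^R$-gates ($R$ may depend on the gate), the layer of $p_h$ reads the inputs, every other layer reads the layer of $p_{i+1}$, and the layer of $p_1$ is a single output gate. Its size is its number of gates. The Strong Exponential Size Hypothesis (SESH) says: for every $h>1$ and all primes $p_1\ne p_2\ne\dots\ne p_h$ there is $c>0$ such that $CC[p_1,\dots,p_h]$-circuits computing the $n$-ary conjunction $\mathrm{AND}_n$ have size $\Omega\bigl(2^{c\,n^{1/(h-1)}}\bigr)$. **Theorem.** Assume SESH. Then for all $h\ge2$ and primes $p_1\neq p_2\neq\dots\neq p_h$: 1. There are a constant $c$ and a probabilistic algorithm that solves $\mathrm{Csat}(\mathbf D[p_1,\dots,p_h])$ in (worst-case) time $O\bigl(2^{c\log^{h-1}|\Gamma|}\bigr)$: it never accepts an unsatisfiable circuit, and accepts every satisfiable one with probability at least $1/2$. 2. There are a constant $c$ and a probabilistic algorithm that solves $\mathrm{Ceqv}(\mathbf D[p_1,\dots,p_h])$ in (worst-case) time $O\bigl(2^{c\log^{h-1}|\Gamma|}\bigr)$: it always accepts if the two output gates are equivalent, and rejects with probability at least $1/2$ if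 they are not. 3. There is a constant $c$ such that, for every circuit $\Gamma$ over $\mathbf D$ with $n$ input gates and every gate of $\Gamma$, computing the function $t:D^n\to D$ say, each value $d$ taken by $t$ is taken often: $|t^{-1}(d)|\ge\Omega\bigl(|D|^n/2^{c\log^{h-1}|\Gamma|}\bigr)$. Here the constants (also those hidden in $O$ and $\Omega$) depend on $p_1,\dots,p_h$ only, and an algorithm is a random access machine with fair coin tosses, unit-cost addition, truncated subtraction and zero tests, which is given an explicit list of the gates of $\Gamma$. -/

import Mathlib

/-! ### Modular counting circuits and the Strong Exponential Size Hypothesis -/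

/-- A counting gate `MOD_q^R` of unbounded fan-in reading from `w` Boolean wires: `mult i` is the
number of times the `i`-th wire is plugged into the gate, and `R` is the accepting set of residues
modulo `q`. -/
structure ModGate (q w : ℕ) where
  mult : Fin w → ℕ
  R : Set (ZMod q)

open Classical in
/-- The gate returns `1` iff the sum modulo `q` of its inputs lies in `R`. -/
noncomputable def ModGate.eval {q w : ℕ} (g : ModGate q w) (x : Fin w → Bool) : Bool :=
  decide ((∑ i, if x i then (g.mult i : ZMod q) else 0) ∈ g.R)

/-- `CCLayers n [p₁, …, p_h] w`: a stack of `h` layers of modular counting gates over `n` Boolean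
inputs. All gates of the `i`-th layer are `MOD_{p_i}`-gates; the layer of `p₁` is the output layer
and has `w` gates, the layer of `p_h` reads the inputs, and every other layer reads the values of
the next one. -/
inductive CCLayers (n : ℕ) : List ℕ → ℕ → Type
  | inputs : CCLayers n [] n
  | layer {ps : List ℕ} {w : ℕ} (q w' : ℕ) (gates : Fin w' → ModGate q w)
      (below : CCLayers n ps w) : CCLayers n (q :: ps) w'

/-- The values on the gates of the output layer. -/
noncomputable def CCLayers.eval {n : ℕ} (x : Fin n → Bool) :
    {ps : List ℕ} → {w : ℕ} → CCLayers n ps w → Fin w → Bool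
  | _, _, .inputs => x
  | _, _, .layer _ _ gates below => fun i => (gates i).eval (below.eval x)

/-- The size: the total number of gates. -/
def CCLayers.size {n : ℕ} : {ps : List ℕ} → {w : ℕ} → CCLayers n ps w → ℕ
  | _, _, .inputs => 0
  | _, _, .layer _ w' _ below => w' + below.size

/-- A `CC[p₁, …, p_h]`-circuit with `n` inputs: the output layer consists of one gate. -/
abbrev CCCircuit (ps : List ℕ) (n : ℕ) : Type := CCLayers n ps 1

/-- The circuit computes the `n`-ary conjunction `AND_n`. -/
def CCCircuit.ComputesAND {ps : List ℕ} {n : ℕ} (Γ : CCCircuit ps n) : Prop :=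
  ∀ x : Fin n → Bool, CCLayers.eval x Γ 0 = true ↔ ∀ i, x i = true

/-- Strong Exponential Size Hypothesis: for every alternating sequence `p₁ ≠ p₂ ≠ … ≠ p_h` of
primes with `h > 1`, the sizes of `CC[p₁, …, p_h]`-circuits computing `AND_n` grow at least as
`Ω(2 ^ (c * n ^ (1 / (h - 1))))` for some `c > 0`. -/
def SESH : Prop :=
  ∀ ps : List ℕ, 2 ≤ ps.length → (∀ q ∈ ps, q.Prime) → ps.IsChain (· ≠ ·) →
    ∃ c K : ℝ, 0 < c ∧ 0 < K ∧ ∃ N : ℕ, ∀ n ≥ N, ∀ Γ : CCCircuit ps n, Γ.ComputesAND →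
      K * (2 : ℝ) ^ (c * (n : ℝ) ^ (1 / ((ps.length : ℝ) - 1))) ≤ (CCLayers.size Γ : ℝ)

/-! ### The algebra `D[p₁, …, p_h]` -/

/-- The universe of `D[p₁, …, p_h]`, with its (componentwise) abelian group structure. Indices are
shifted by one: the prime `p_{j+1}` is `p j`. -/
abbrev DAlg {h : ℕ} (p : Fin h → ℕ) : Type := (i : Fin h) → ZMod (p i)

/-- `e_j (x) = (0, …, 0, x_j, 0, …, 0)`. -/
def DAlg.e {h : ℕ} {p : Fin h → ℕ} (j : Fin h) (x : DAlg p) : DAlg p :=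
  Pi.single j (x j)

/-- `v_j (x) = (0, …, 0, b_j (x_{j+1}), 0, …, 0)` with `b_j (0) = 0` and `b_j (a) = 1` for
`a ≠ 0`. -/
def DAlg.v {h : ℕ} {p : Fin h → ℕ} (j : ℕ) (hj : j + 1 < h) (x : DAlg p) : DAlg p :=
  Pi.single ⟨j, Nat.lt_of_succ_lt hj⟩ (if x ⟨j + 1, hj⟩ = 0 then 0 else 1)

/-! ### Circuits over `D[p₁, …, p_h]` -/

/-- A gate number `k` of a circuit over `D[p₁, …, p_h]`: an input gate, a constant, or a basic
operation applied to earlier gates. -/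
inductive DGate {h : ℕ} (p : Fin h → ℕ) (k : ℕ) : Type
  | input : DGate p k
  | const (d : DAlg p) : DGate p k
  | add (a b : Fin k) : DGate p k
  | neg (a : Fin k) : DGate p k
  | e (j : Fin h) (a : Fin k) : DGate p k
  | v (j : ℕ) (hj : j + 1 < h) (a : Fin k) : DGate p k

/-- A circuit over `D[p₁, …, p_h]`, with its gates (the input gates included) listed in a
topological order, and with two designated output gates. -/
structure DCircuit {h : ℕ} (p : Fin h → ℕ) where
  size : ℕ
  gate : (k : Fin size) → DGate p k
  out₁ : Fin size
  out₂ : Fin size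

namespace DCircuit

variable {h : ℕ} {p : Fin h → ℕ}

/-- The input gates, which are the variables of the circuit. -/
abbrev Input (Γ : DCircuit p) : Type := {k : Fin Γ.size // Γ.gate k = DGate.input}

/-- The value on the gate number `k` when the input gates carry the values `x`. -/
def val (Γ : DCircuit p) (x : Γ.Input → DAlg p) (k : Fin Γ.size) : DAlg p :=
  match hk : Γ.gate k with
  | .input => x ⟨k, hk⟩
  | .const d => d
  | .add a b =>
      Γ.val x ⟨a, a.isLt.trans k.isLt⟩ + Γ.val x ⟨b, b.isLt.trans k.isLt⟩
  | .neg a => - Γ.val x ⟨a, a.isLt.trans k.isLt⟩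
  | .e j a => DAlg.e j (Γ.val x ⟨a, a.isLt.trans k.isLt⟩)
  | .v j hj a => DAlg.v j hj (Γ.val x ⟨a, a.isLt.trans k.isLt⟩)
termination_by k.val

/-- Circuit satisfiability: some input gives the same values on the two output gates. -/
def Satisfiable (Γ : DCircuit p) : Prop :=
  ∃ x : Γ.Input → DAlg p, Γ.val x Γ.out₁ = Γ.val x Γ.out₂

/-- Circuit equivalence: every input gives the same values on the two output gates. -/
def Equivalent (Γ : DCircuit p) : Prop :=
  ∀ x : Γ.Input → DAlg p, Γ.val x Γ.out₁ = Γ.val x Γ.out₂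

end DCircuit

/-- A gate as a record of `h + 3` numbers: the kind of the gate, two arguments, and the
coordinates of a constant (unused entries are `0`). -/
def DGate.encode {h : ℕ} {p : Fin h → ℕ} {k : ℕ} : DGate p k → List ℕ
  | .input => [0, 0, 0] ++ List.replicate h 0
  | .const d => [1, 0, 0] ++ List.ofFn (fun i => (d i).val)
  | .add a b => [2, (a : ℕ), (b : ℕ)] ++ List.replicate h 0
  | .neg a => [3, (a : ℕ), 0] ++ List.replicate h 0
  | .e j a => [4, (j : ℕ), (a : ℕ)] ++ List.replicate h 0
  | .v j _ a => [5, j, (a : ℕ)] ++ List.replicate h 0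

/-- The description of a circuit that is given to an algorithm: the size, the two output gates,
and the list of the gates. -/
def DCircuit.encode {h : ℕ} {p : Fin h → ℕ} (Γ : DCircuit p) : List ℕ :=
  [Γ.size, (Γ.out₁ : ℕ), (Γ.out₂ : ℕ)] ++ (List.ofFn (fun k => (Γ.gate k).encode)).flatten

/-! ### Probabilistic algorithms: random access machines tossing fair coins -/

/-- Programs of a probabilistic random access machine. The machine has registers and a memory that
is addressed indirectly, both holding natural numbers; its arithmetic is addition and truncated
subtraction only, so that its unit-cost time is polynomially related to that of Turing machines. -/
inductive RProg : Type
  /-- do nothing -/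
  | skip : RProg
  /-- `reg r := n` -/
  | const (r n : ℕ) : RProg
  /-- `reg r := reg a + reg b` -/
  | add (r a b : ℕ) : RProg
  /-- `reg r := reg a - reg b` (truncated) -/
  | sub (r a b : ℕ) : RProg
  /-- `reg r := mem (reg a)` -/
  | load (r a : ℕ) : RProg
  /-- `mem (reg a) := reg r` -/
  | store (a r : ℕ) : RProg
  /-- `reg r :=` the outcome, `0` or `1`, of a fresh toss of a fair coin -/
  | flip (r : ℕ) : RProg
  /-- sequential composition -/
  | seq (c d : RProg) : RProg
  /-- `if reg r ≠ 0 then c else d` -/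
  | ite (r : ℕ) (c d : RProg) : RProg
  /-- `while reg r ≠ 0 do c` -/
  | loop (r : ℕ) (c : RProg) : RProg

/-- A state of the machine; `coins` is the sequence of outcomes of the tosses still to come. -/
structure RState where
  reg : ℕ → ℕ
  mem : ℕ → ℕ
  coins : ℕ → Bool

/-- The state after `reg r := n`. -/
def RState.set (s : RState) (r n : ℕ) : RState := { s with reg := Function.update s.reg r n }

/-- `Exec c s s' t`: the program `c`, started in the state `s`, halts in the state `s'` after
exactly `t` steps. Every elementary instruction and every evaluation of a test is one step. -/
inductive Exec : RProg → RState → RState → ℕ → Prop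
  | skip (s : RState) : Exec .skip s s 1
  | const (s : RState) (r n : ℕ) : Exec (.const r n) s (s.set r n) 1
  | add (s : RState) (r a b : ℕ) : Exec (.add r a b) s (s.set r (s.reg a + s.reg b)) 1
  | sub (s : RState) (r a b : ℕ) : Exec (.sub r a b) s (s.set r (s.reg a - s.reg b)) 1
  | load (s : RState) (r a : ℕ) : Exec (.load r a) s (s.set r (s.mem (s.reg a))) 1
  | store (s : RState) (a r : ℕ) :
      Exec (.store a r) s { s with mem := Function.update s.mem (s.reg a) (s.reg r) } 1
  | flip (s : RState) (r : ℕ) :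
      Exec (.flip r) s
        { s.set r (if s.coins 0 then 1 else 0) with coins := fun i => s.coins (i + 1) } 1
  | seq {c d : RProg} {s s' s'' : RState} {t t' : ℕ} :
      Exec c s s' t → Exec d s' s'' t' → Exec (.seq c d) s s'' (t + t')
  | iteTrue {r : ℕ} {c d : RProg} {s s' : RState} {t : ℕ} :
      s.reg r ≠ 0 → Exec c s s' t → Exec (.ite r c d) s s' (t + 1)
  | iteFalse {r : ℕ} {c d : RProg} {s s' : RState} {t : ℕ} :
      s.reg r = 0 → Exec d s s' t → Exec (.ite r c d) s s' (t + 1)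
  | loopStop {r : ℕ} {c : RProg} {s : RState} :
      s.reg r = 0 → Exec (.loop r c) s s 1
  | loopStep {r : ℕ} {c : RProg} {s s' s'' : RState} {t t' : ℕ} :
      s.reg r ≠ 0 → Exec c s s' t → Exec (.loop r c) s' s'' t' →
        Exec (.loop r c) s s'' (t + t' + 1)

/-- Once the coins are fixed, the final state and the number of steps are determined. -/
theorem Exec.unique {c : RProg} {s s₁ s₂ : RState} {t₁ t₂ : ℕ}
    (h₁ : Exec c s s₁ t₁) (h₂ : Exec c s s₂ t₂) : s₁ = s₂ ∧ t₁ = t₂ := by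
  induction h₁ generalizing s₂ t₂ with
  | skip | const | add | sub | load | store | flip => cases h₂; exact ⟨rfl, rfl⟩
  | seq _ _ ih₁ ih₂ =>
    cases h₂ with
    | seq g₁ g₂ =>
      obtain ⟨rfl, rfl⟩ := ih₁ g₁
      obtain ⟨rfl, rfl⟩ := ih₂ g₂
      exact ⟨rfl, rfl⟩
  | iteTrue hr _ ih =>
    cases h₂ with
    | iteTrue _ g => obtain ⟨rfl, rfl⟩ := ih g; exact ⟨rfl, rfl⟩
    | iteFalse h0 _ => exact absurd h0 hr
  | iteFalse hr _ ih =>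
    cases h₂ with
    | iteTrue h0 _ => exact absurd hr h0
    | iteFalse _ g => obtain ⟨rfl, rfl⟩ := ih g; exact ⟨rfl, rfl⟩
  | loopStop hr =>
    cases h₂ with
    | loopStop _ => exact ⟨rfl, rfl⟩
    | loopStep h0 _ _ => exact absurd hr h0
  | loopStep hr _ _ ih₁ ih₂ =>
    cases h₂ with
    | loopStop h0 => exact absurd h0 hr
    | loopStep _ g₁ g₂ =>
      obtain ⟨rfl, rfl⟩ := ih₁ g₁
      obtain ⟨rfl, rfl⟩ := ih₂ g₂
      exact ⟨rfl, rfl⟩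

/-- The initial state: the input word `w` is in the memory, its length in the register `0`, and
everything else is `0`. -/
def RState.init (w : List ℕ) (ω : ℕ → Bool) : RState where
  reg := fun r => if r = 0 then w.length else 0
  mem := fun k => w.getD k 0
  coins := ω

/-- With the coin tosses `ω`, the program halts on the input `w` with `b` in the register `0`. -/
def RProg.Returns (A : RProg) (w : List ℕ) (ω : ℕ → Bool) (b : ℕ) : Prop :=
  ∃ s t, Exec A (RState.init w ω) s t ∧ s.reg 0 = b

/-- Whatever the coin tosses, the program halts on the input `w` after at most `T` steps. -/
def RProg.RunsWithin (A : RProg) (w : List ℕ) (T : ℝ) : Prop :=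
  ∀ ω, ∃ s t, Exec A (RState.init w ω) s t ∧ (t : ℝ) ≤ T

/-- The law of an infinite sequence of independent tosses of a fair coin. -/
noncomputable def coinLaw : MeasureTheory.Measure (ℕ → Bool) :=
  MeasureTheory.Measure.infinitePi (fun _ => (PMF.uniformOfFintype Bool).toMeasure)

/-! ### Affine forms over the output layer of a stack of counting gates -/

/-! The heart of the theorem is a density statement: if an equation `T x = 0`, with `T` affine in
the gates of a circuit of size s, has a solution at all, then it is solved by a fraction at least
2^(-O(log^(h-1) s)) of the inputs. Part 3 is an instance of it, and parts 1 and 2 follow by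
evaluating the circuit at many independent random inputs.

Suppose the solution set U in the finite group G of all inputs satisfies 2^m |U| < |G|. Starting
from a solution a, directions u_l can be chosen greedily so that the cube of all points a + Σ_{y_l =
0} u_l meets U in a only (`exists_cube_avoiding`). On this cube `T = 0` is the conjunction of y_1,
…, y_m. On the other hand, D behaves like a counting circuit. Only the operations v_j connect
different coordinates, so modulo p_j the j-th coordinates of the gates are affine in the inputs and
in zero tests of the (j+1)-st coordinates. A function of boundedly many affine forms modulo q is a
linear combination modulo r ≠ q of hyperplane indicators, and each of these is one `MOD_q`-gate
(`sum_hyperplane`, `exists_layer`). So a layer of polynomially many gates leads from each coordinate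
to the preceding one, and the equations T_j = 0 are merged into a single form on the way
(`exists_layers`). This computes AND_m with size polynomial in s + m (`exists_computesAND`), and
SESH forces m = O(log^(h-1) s) (`SESH.exists_bound`, `exists_density_bound`).

For the algorithms, a residue is sampled by reducing a random K-bit number with K = s + const, so
that every input is drawn with at least half of its uniform probability (`le_card_sampleFin_eq`).
Hence 2^(M+1) trials hit a set of density 2^(-M) with probability at least 1/2
(`half_le_coinLaw_exists_sample_mem`). An input that is found is a certificate, so the error is
one-sided. -/

namespace CCLayers

variable {m : ℕ}

/-- The functions of the inputs that are affine combinations modulo `r` of the Boolean values on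
the output layer. -/
def affineSpan {ps : List ℕ} {w : ℕ} (L : CCLayers m ps w) (r : ℕ) :
    Submodule (ZMod r) ((Fin m → Bool) → ZMod r) :=
  Submodule.span (ZMod r)
    (insert 1 (Set.range fun (i : Fin w) (y : Fin m → Bool) => if L.eval y i then (1 : ZMod r) else 0))

theorem one_mem_affineSpan {ps : List ℕ} {w : ℕ} (L : CCLayers m ps w) (r : ℕ) :
    1 ∈ L.affineSpan r :=
  Submodule.subset_span (Set.mem_insert _ _)

theorem eval_mem_affineSpan {ps : List ℕ} {w : ℕ} (L : CCLayers m ps w) (r : ℕ) (i : Fin w) :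
    (fun y => if L.eval y i then (1 : ZMod r) else 0) ∈ L.affineSpan r :=
  Submodule.subset_span (Set.mem_insert_of_mem _ ⟨i, rfl⟩)

/-- The coefficients serve later as wire multiplicities of a gate, and the constant term is absorbed
into its accepting set. -/
theorem exists_coeff_of_mem_affineSpan {ps : List ℕ} {w : ℕ} {L : CCLayers m ps w} {r : ℕ}
    {f : (Fin m → Bool) → ZMod r} (hf : f ∈ L.affineSpan r) :
    ∃ (c : Fin w → ZMod r) (κ : ZMod r), ∀ y, f y = κ + ∑ i, if L.eval y i then c i else 0 := by
  induction hf using Submodule.span_induction with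
  | mem f hf =>
    rcases hf with rfl | ⟨i, rfl⟩
    · exact ⟨0, 1, fun y => by simp⟩
    · refine ⟨Pi.single i 1, 0, fun y => ?_⟩
      rw [Finset.sum_eq_single i]
      · simp
      · intro b _ hb; simp [Pi.single_eq_of_ne hb]
      · simp
  | zero => exact ⟨0, 0, fun y => by simp⟩
  | add f g _ _ hf hg =>
    obtain ⟨c, κ, hc⟩ := hf
    obtain ⟨d, l, hd⟩ := hg
    refine ⟨c + d, κ + l, fun y => ?_⟩
    have : ∀ i, (if L.eval y i then (c + d) i else 0)
        = (if L.eval y i then c i else 0) + (if L.eval y i then d i else 0) := by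
      intro i; split_ifs <;> simp
    rw [Pi.add_apply, hc, hd, Finset.sum_congr rfl fun i _ => this i, Finset.sum_add_distrib]
    ring
  | smul a f _ hf =>
    obtain ⟨c, κ, hc⟩ := hf
    refine ⟨a • c, a * κ, fun y => ?_⟩
    simp only [Pi.smul_apply, hc, smul_eq_mul, mul_add, Finset.mul_sum, mul_ite, mul_zero]

/-- The functions that are linear combinations of functions of `k` of the forms `G i`. -/
def jointSpan {ι : Type*} {q : ℕ} (G : ι → (Fin m → Bool) → ZMod q) (k r : ℕ) :
    Submodule (ZMod r) ((Fin m → Bool) → ZMod r) :=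
  Submodule.span (ZMod r)
    {φ | ∃ (i : Fin k → ι) (F : (Fin k → ZMod q) → ZMod r), φ = fun y => F fun a => G (i a) y}

section jointSpan

variable {ι : Type*} {q : ℕ} {G : ι → (Fin m → Bool) → ZMod q} {k l r : ℕ}

/-- A product of two generators is a generator for the concatenated tuple of forms. Counting the
forms involved in this way bounds the exponent in the size of the next layer. -/
theorem mul_mem_jointSpan {φ ψ : (Fin m → Bool) → ZMod r} (hφ : φ ∈ jointSpan G k r)
    (hψ : ψ ∈ jointSpan G l r) : φ * ψ ∈ jointSpan G (k + l) r := by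
  have h := Submodule.mul_mem_mul hφ hψ
  rw [jointSpan, jointSpan, Submodule.span_mul_span] at h
  refine Submodule.span_mono ?_ h
  rintro _ ⟨_, ⟨i, F, rfl⟩, _, ⟨j, F', rfl⟩, rfl⟩
  refine ⟨Fin.append i j, fun v => F (fun a => v (Fin.castAdd l a)) * F' fun a => v (Fin.natAdd k a),
    ?_⟩
  funext y
  simp

theorem comp_mem_jointSpan (i : ι) (F : ZMod q → ZMod r) :
    (fun y => F (G i y)) ∈ jointSpan G 1 r :=
  Submodule.subset_span ⟨fun _ => i, fun v => F (v 0), rfl⟩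

theorem one_mem_jointSpan [Nonempty ι] : (1 : (Fin m → Bool) → ZMod r) ∈ jointSpan G k r :=
  Submodule.subset_span ⟨fun _ => Classical.arbitrary ι, fun _ => 1, rfl⟩

theorem pow_mem_jointSpan [Nonempty ι] {φ : (Fin m → Bool) → ZMod r} (hφ : φ ∈ jointSpan G 1 r)
    (k : ℕ) : φ ^ k ∈ jointSpan G k r := by
  induction k with
  | zero => rw [pow_zero]; exact one_mem_jointSpan
  | succ k ih => rw [pow_succ]; exact mul_mem_jointSpan ih hφ

theorem jointSpan_mono [Nonempty ι] (hkl : k ≤ l) : jointSpan G k r ≤ jointSpan G l r := by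
  intro φ hφ
  obtain ⟨d, rfl⟩ := Nat.exists_eq_add_of_le hkl
  simpa using mul_mem_jointSpan hφ (one_mem_jointSpan (G := G) (k := d))

end jointSpan

/-- Orthogonality: hyperplane indicators detect the zero vector. -/
theorem sum_hyperplane {q : ℕ} [Fact q.Prime] {P r : ℕ} (v : Fin P → ZMod q) :
    (∑ c : Fin P → ZMod q, ((if ∑ a, c a * v a = 0 then (1 : ZMod r) else 0)
        - if ∑ a, c a * v a = 1 then (1 : ZMod r) else 0))
      = if v = 0 then (q : ZMod r) ^ P else 0 := by
  split_ifs with hv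
  · subst hv
    simp [ZMod.card]
  -- At an index with `v b ≠ 0`, translation by `(v b)⁻¹` in direction `b` maps the hyperplane c · v
  -- = 0 onto c · v = 1, so the two counts cancel.
  · obtain ⟨b, hb⟩ := Function.ne_iff.mp hv
    rw [Finset.sum_sub_distrib, sub_eq_zero]
    refine Fintype.sum_equiv (Equiv.addRight (Pi.single b (v b)⁻¹)) _ _ fun c => ?_
    have : ∑ a, (c + (Pi.single b (v b)⁻¹ : Fin P → ZMod q)) a * v a
        = ∑ a, c a * v a + 1 := by
      simp only [Pi.add_apply, add_mul, Finset.sum_add_distrib, add_right_inj]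
      rw [Finset.sum_eq_single b]
      · simp only [Pi.single_eq_same]; exact inv_mul_cancel₀ hb
      · intro a _ ha; simp [Pi.single_eq_of_ne ha]
      · simp
    simp only [Equiv.coe_addRight, this, add_eq_right]

/-- Over any stack of layers there is a layer of `MOD_q`-gates whose affine forms modulo `r ≠ q`
contain all functions of `P` affine forms modulo `q` taken from a given list. -/
theorem exists_layer {ps : List ℕ} {w : ℕ} (L : CCLayers m ps w) (q P : ℕ) [Fact q.Prime]
    {ι : Type*} [Fintype ι] (G : ι → (Fin m → Bool) → ZMod q) (hG : ∀ i, G i ∈ L.affineSpan q) :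
    ∃ (w' : ℕ) (L' : CCLayers m (q :: ps) w'), L'.size = w' + L.size ∧
      w' = (Fintype.card ι * q) ^ P * q ∧
      ∀ r, r.Prime → r ≠ q → jointSpan G P r ≤ L'.affineSpan r := by
  classical
  choose c κ hc using fun i => exists_coeff_of_mem_affineSpan (hG i)
  let X := (Fin P → ι) × (Fin P → ZMod q) × ZMod q
  let E : Fin (Fintype.card X) ≃ X := (Fintype.equivFin X).symm
  -- One gate for each triple of a `P`-tuple of forms, a coefficient vector d and a value s. It
  -- tests d · G = s, with the constant terms of the forms moved to the accepting residue.
  let gates : Fin (Fintype.card X) → ModGate q w := fun z =>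
    { mult := fun k => (∑ a, (E z).2.1 a * c ((E z).1 a) k).val
      R := {(E z).2.2 - ∑ a, (E z).2.1 a * κ ((E z).1 a)} }
  refine ⟨_, .layer q _ gates L, rfl, ?_, ?_⟩
  · simp [X, ZMod.card, mul_pow, mul_assoc]
  intro r hr hrq
  have hind : ∀ (i : Fin P → ι) (d : Fin P → ZMod q) (s : ZMod q),
      (fun y => if ∑ a, d a * G (i a) y = s then (1 : ZMod r) else 0)
        ∈ (CCLayers.layer q _ gates L).affineSpan r := by
    intro i d s
    convert eval_mem_affineSpan (CCLayers.layer q _ gates L) r (E.symm (i, d, s)) using 3 with y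
    simp only [CCLayers.eval, ModGate.eval, gates, Equiv.apply_symm_apply, ZMod.natCast_val,
      ZMod.cast_id', id_eq, Set.mem_singleton_iff, decide_eq_true_eq, hc, mul_add,
      Finset.sum_add_distrib]
    rw [eq_sub_iff_add_eq, add_comm]
    have : ∑ k, (if L.eval y k = true then ∑ a, d a * c (i a) k else 0)
        = ∑ a, d a * ∑ k, if L.eval y k = true then c (i a) k else 0 := by
      simp only [Finset.mul_sum, mul_ite, mul_zero]
      rw [Finset.sum_comm]
      refine Finset.sum_congr rfl fun k _ => ?_
      split_ifs <;> simp
    rw [this]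
  have := Fact.mk hr
  -- Orthogonality produces the factor `q ^ P`, which can be divided out only because r ≠ q.
  have hq : (q : ZMod r) ≠ 0 := by
    rw [Ne, ZMod.natCast_eq_zero_iff]
    exact fun h => hrq ((Nat.prime_dvd_prime_iff_eq hr Fact.out).mp h)
  refine Submodule.span_le.mpr ?_
  rintro _ ⟨i, F, rfl⟩
  -- `F` is expanded into point indicators, and each of these into hyperplane indicators.
  have key : (fun y => F fun a => G (i a) y) =
      ∑ v : Fin P → ZMod q, (F v * ((q : ZMod r) ^ P)⁻¹) • ∑ d : Fin P → ZMod q,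
        ((fun y => if ∑ a, d a * G (i a) y = ∑ a, d a * v a then (1 : ZMod r) else 0)
        - fun y => if ∑ a, d a * G (i a) y = 1 + ∑ a, d a * v a then (1 : ZMod r) else 0) := by
    funext y
    have h1 : ∀ v : Fin P → ZMod q, ∑ d : Fin P → ZMod q,
        ((if ∑ a, d a * G (i a) y = ∑ a, d a * v a then (1 : ZMod r) else 0)
        - if ∑ a, d a * G (i a) y = 1 + ∑ a, d a * v a then (1 : ZMod r) else 0)
        = if (fun a => G (i a) y) = v then (q : ZMod r) ^ P else 0 := by
      intro v
      have := sum_hyperplane (r := r) ((fun a => G (i a) y) - v)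
      simp only [sub_eq_zero (b := v)] at this
      rw [← this]
      simp only [Pi.sub_apply, mul_sub, Finset.sum_sub_distrib, sub_eq_iff_eq_add, zero_add]
    simp only [Finset.sum_apply, Pi.smul_apply, Pi.sub_apply, h1, smul_eq_mul, mul_ite, mul_zero,
      Finset.sum_ite_eq, Finset.mem_univ, if_true]
    rw [inv_mul_cancel_right₀ (pow_ne_zero _ hq)]
  rw [key]
  exact Submodule.sum_mem _ fun v _ => Submodule.smul_mem _ _ <| Submodule.sum_mem _ fun d _ =>
    Submodule.sub_mem _ (hind _ _ _) (hind _ _ _)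

end CCLayers

/-! ### Counting circuits for systems of equations over `D` on a Boolean cube -/

namespace DCircuit

variable {h : ℕ} {p : Fin h → ℕ}

theorem val_input (Γ : DCircuit p) (x : Γ.Input → DAlg p) {k : Fin Γ.size}
    (hk : Γ.gate k = .input) : Γ.val x k = x ⟨k, hk⟩ := by
  rw [val]; split <;> simp_all

theorem val_const (Γ : DCircuit p) (x : Γ.Input → DAlg p) {k : Fin Γ.size} {d : DAlg p}
    (hk : Γ.gate k = .const d) : Γ.val x k = d := by
  rw [val]; split <;> simp_all

theorem val_add (Γ : DCircuit p) (x : Γ.Input → DAlg p) {k : Fin Γ.size} {a b : Fin k}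
    (hk : Γ.gate k = .add a b) : Γ.val x k =
      Γ.val x ⟨a, a.isLt.trans k.isLt⟩ + Γ.val x ⟨b, b.isLt.trans k.isLt⟩ := by
  rw [val]; split <;> simp_all

theorem val_neg (Γ : DCircuit p) (x : Γ.Input → DAlg p) {k : Fin Γ.size} {a : Fin k}
    (hk : Γ.gate k = .neg a) : Γ.val x k = - Γ.val x ⟨a, a.isLt.trans k.isLt⟩ := by
  rw [val]; split <;> simp_all

theorem val_e (Γ : DCircuit p) (x : Γ.Input → DAlg p) {k : Fin Γ.size} {j : Fin h} {a : Fin k}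
    (hk : Γ.gate k = .e j a) :
    Γ.val x k = DAlg.e j (Γ.val x ⟨a, a.isLt.trans k.isLt⟩) := by
  rw [val]; split <;> simp_all

theorem val_v (Γ : DCircuit p) (x : Γ.Input → DAlg p) {k : Fin Γ.size} {j : ℕ} {hj : j + 1 < h}
    {a : Fin k} (hk : Γ.gate k = .v j hj a) :
    Γ.val x k = DAlg.v j hj (Γ.val x ⟨a, a.isLt.trans k.isLt⟩) := by
  rw [val]; split <;> simp_all
  obtain ⟨rfl, rfl⟩ := hk
  rfl

/-- The `j`-th coordinates of the gates are affine in the inputs and in the tests for zero of the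
next coordinates of the gates. -/
theorem val_coord_mem (Γ : DCircuit p) {Y : Type*} (x : Y → Γ.Input → DAlg p) (j : Fin h)
    (S : Submodule (ZMod (p j)) (Y → ZMod (p j))) (h1 : (1 : Y → ZMod (p j)) ∈ S)
    (hx : ∀ i, (fun y => x y i j) ∈ S)
    (hv : ∀ (hj : j.val + 1 < h) (k : Fin Γ.size),
      (fun y => if Γ.val (x y) k ⟨j + 1, hj⟩ = 0 then (0 : ZMod (p j)) else 1) ∈ S)
    (k : Fin Γ.size) : (fun y => Γ.val (x y) k j) ∈ S := by
  obtain ⟨k, hk⟩ := k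
  induction k using Nat.strong_induction_on with
  | _ k ih =>
  rcases hg : Γ.gate ⟨k, hk⟩ with _ | d | ⟨a, b⟩ | a | ⟨i, a⟩ | ⟨i, hi, a⟩
  · simp only [Γ.val_input _ hg]
    exact hx _
  · simp only [Γ.val_const _ hg]
    convert S.smul_mem (d j) h1 using 1
    funext y; simp
  · simp only [Γ.val_add _ hg]
    exact S.add_mem (ih a a.isLt _) (ih b b.isLt _)
  · simp only [Γ.val_neg _ hg]
    exact S.neg_mem (ih a a.isLt _)
  · simp only [Γ.val_e _ hg]
    by_cases hij : i = j
    · subst hij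
      simpa [DAlg.e] using ih a a.isLt _
    · convert S.zero_mem using 1
      funext y
      simp [DAlg.e, Pi.single_eq_of_ne (Ne.symm hij)]
  · simp only [Γ.val_v _ hg]
    by_cases hij : (⟨i, Nat.lt_of_succ_lt hi⟩ : Fin h) = j
    · subst hij
      simpa [DAlg.v] using hv hi ⟨a, a.isLt.trans hk⟩
    · convert S.zero_mem using 1
      funext y
      simp [DAlg.v, Pi.single_eq_of_ne (Ne.symm hij)]

/-- The number of gates in one layer. -/
def layerBound (P s m : ℕ) : ℕ := ((s + m + 1) * P) ^ P * P

/-- Induction from the last coordinate downwards; `L` consists of the layers of the primes after `p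
j`. The form `Z` carries the conjunction of the equations at all coordinates from `j` on. The bits
`y l` must be carried along too, since a layer reads only the layer beneath it while input gates
contribute to every coordinate. In `hx` and `hT`, being affine is expressed by membership in every
submodule that contains `1` and the generators. -/
theorem exists_layers (hprime : ∀ i, (p i).Prime)
    (halt : ∀ (i : ℕ) (hi : i + 1 < h), p ⟨i, Nat.lt_of_succ_lt hi⟩ ≠ p ⟨i + 1, hi⟩)
    {P : ℕ} (hP : ∀ i, p i ≤ P) (Γ : DCircuit p) {m : ℕ}
    (x : (Fin m → Bool) → Γ.Input → DAlg p)
    (hx : ∀ i j (S : Submodule (ZMod (p j)) ((Fin m → Bool) → ZMod (p j))), 1 ∈ S →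
      (∀ l, (fun y => if y l then 1 else 0) ∈ S) → (fun y => x y i j) ∈ S)
    (T : (Fin m → Bool) → DAlg p)
    (hT : ∀ j (S : Submodule (ZMod (p j)) ((Fin m → Bool) → ZMod (p j))), 1 ∈ S →
      (∀ k, (fun y => Γ.val (x y) k j) ∈ S) → (fun y => T y j) ∈ S)
    (d : ℕ) (j : Fin h) (hd : j.val + d + 1 = h) :
    ∃ (w : ℕ) (L : CCLayers m ((List.ofFn p).drop (j + 1)) w)
      (Z : (Fin m → Bool) → ZMod (p j)), L.size ≤ d * layerBound P Γ.size m ∧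
      (∀ y, Z y = 0 ↔ ∀ i, j ≤ i → T y i = 0) ∧ Z ∈ L.affineSpan (p j) ∧
      (∀ l, (fun y => if y l then 1 else 0) ∈ L.affineSpan (p j)) ∧
      ∀ k, (fun y => Γ.val (x y) k j) ∈ L.affineSpan (p j) := by
  induction d generalizing j with
  | zero =>
    have hnil : (List.ofFn p).drop (j + 1) = [] := by
      rw [List.drop_eq_nil_iff, List.length_ofFn]; omega
    rw [hnil]
    have hin : ∀ l : Fin m, (fun y : Fin m → Bool => if y l then (1 : ZMod (p j)) else 0)
        ∈ (CCLayers.inputs : CCLayers m [] m).affineSpan (p j) := fun l =>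
      CCLayers.eval_mem_affineSpan CCLayers.inputs (p j) l
    have hval := Γ.val_coord_mem x j _ (CCLayers.one_mem_affineSpan _ _)
      (fun i => hx i j _ (CCLayers.one_mem_affineSpan _ _) hin) (fun hj => by omega)
    refine ⟨m, CCLayers.inputs, fun y => T y j, by simp [CCLayers.size], fun y => ?_,
      hT j _ (CCLayers.one_mem_affineSpan _ _) hval, hin, hval⟩
    refine ⟨fun h0 i hi => ?_, fun h0 => h0 j le_rfl⟩
    have : i = j := by ext; have : j.val ≤ i.val := hi; omega
    rw [this]; exact h0
  | succ d ih =>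
    have hj : j.val + 1 < h := by omega
    set j' : Fin h := ⟨j + 1, hj⟩ with hj'
    obtain ⟨w, L, Z, hsize, hZ, hZL, hinL, hvalL⟩ := ih j' (by simp only [hj']; omega)
    have hcons : (List.ofFn p).drop (j + 1) = p j' :: (List.ofFn p).drop (j' + 1) := by
      rw [List.drop_eq_getElem_cons (by simpa using hj)]
      simp [hj']
    have := Fact.mk (hprime j)
    have := Fact.mk (hprime j')
    let G : Option (Fin Γ.size ⊕ Fin m) → (Fin m → Bool) → ZMod (p j') := fun
      | none => Z
      | some (.inl k) => fun y => Γ.val (x y) k j'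
      | some (.inr l) => fun y => if y l then 1 else 0
    have hG : ∀ i, G i ∈ L.affineSpan (p j') := by
      rintro (_ | _ | _)
      exacts [hZL, hvalL _, hinL _]
    -- Functions of `p j` forms suffice: gate coordinates and bits need one form each, and the new
    -- `Z` needs `p j - 1` for a power of `T y j` and one more for the test of the old `Z`.
    obtain ⟨w', L', hsize', hw', hspan⟩ := CCLayers.exists_layer L (p j') (p j) G hG
    replace hspan := hspan (p j) (hprime j) (halt j hj)
    have hpos := (hprime j).pos
    have hmono := CCLayers.jointSpan_mono (G := G) (r := p j) (Nat.succ_le_of_lt hpos)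
    have hin : ∀ l, (fun y : Fin m → Bool => if y l then (1 : ZMod (p j)) else 0)
        ∈ CCLayers.jointSpan G 1 (p j) := by
      intro l
      convert CCLayers.comp_mem_jointSpan (G := G) (some (.inr l))
        (fun z => if z = 1 then (1 : ZMod (p j)) else 0) using 2 with y
      simp only [G]
      split_ifs <;> simp_all
    have hval := Γ.val_coord_mem x j (CCLayers.jointSpan G 1 (p j)) CCLayers.one_mem_jointSpan
      (fun i => hx i j _ CCLayers.one_mem_jointSpan hin) (fun hj k =>
        CCLayers.comp_mem_jointSpan (G := G) (some (.inl k))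
          (fun z => if z = 0 then (0 : ZMod (p j)) else 1))
    have hTj := hT j _ CCLayers.one_mem_jointSpan hval
    have hrest := CCLayers.comp_mem_jointSpan (G := G) none
      (fun z => if z = 0 then (1 : ZMod (p j)) else 0)
    have hprod := CCLayers.mul_mem_jointSpan (CCLayers.mul_mem_jointSpan
      (CCLayers.one_mem_jointSpan (k := 0)) (CCLayers.pow_mem_jointSpan hTj (p j - 1))) hrest
    have hprod' := CCLayers.mul_mem_jointSpan
      (CCLayers.one_mem_jointSpan (G := G) (k := p j - 1) (r := p j)) hrest
    have hpe : 0 + (p j - 1) + 1 = p j := by omega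
    have hpe' : p j - 1 + 1 = p j := by omega
    rw [hpe] at hprod
    rw [hpe'] at hprod'
    rw [hcons]
    -- By Fermat, `1 - T y j ^ (p j - 1)` is the indicator of `T y j = 0`. Its product with the test
    -- of the old `Z` indicates that both vanish, and the new `Z` is the complement.
    refine ⟨w', L', 1 - (1 - fun y => T y j ^ (p j - 1)) *
      fun y => if G none y = 0 then (1 : ZMod (p j)) else 0, ?_, fun y => ?_, ?_,
      fun l => hspan (hmono (hin l)), fun k => hspan (hmono (hval k))⟩
    · rw [hsize', Nat.add_mul, Nat.one_mul, add_comm]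
      refine Nat.add_le_add hsize ?_
      rw [hw', layerBound]
      simp only [Fintype.card_option, Fintype.card_sum, Fintype.card_fin]
      have hp1 := hP j
      have hp2 := hP j'
      have hp3 := (hprime j').pos
      have : ((Γ.size + m + 1) * p j') ^ p j ≤ ((Γ.size + m + 1) * P) ^ P :=
        (Nat.pow_le_pow_left (Nat.mul_le_mul_left _ hp2) _).trans
          (Nat.pow_le_pow_right (Nat.mul_pos (Nat.succ_pos _) (hp3.trans_le hp2)) hp1)
      exact Nat.mul_le_mul this hp2
    · have hsplit : (∀ i, j ≤ i → T y i = 0) ↔ T y j = 0 ∧ Z y = 0 := by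
        rw [hZ]
        refine ⟨fun H => ⟨H j le_rfl, fun i hi => H i ?_⟩, fun H i hi => ?_⟩
        · rw [Fin.le_def] at hi ⊢; simp only [hj'] at hi; omega
        · rcases eq_or_lt_of_le hi with rfl | hlt
          · exact H.1
          · exact H.2 i (by rw [Fin.le_def]; simp only [hj']; exact hlt)
      rw [hsplit]
      simp only [Pi.sub_apply, Pi.mul_apply, Pi.one_apply, G]
      by_cases hz : Z y = 0
      · by_cases ht : T y j = 0
        · have : p j - 1 ≠ 0 := by have := (hprime j).two_le; omega
          simp [hz, ht, this]
        · simp [hz, ht, ZMod.pow_card_sub_one_eq_one]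
      · simp [hz]
    · refine Submodule.sub_mem _ (CCLayers.one_mem_affineSpan _ _) ?_
      rw [sub_mul, one_mul]
      refine hspan (Submodule.sub_mem _ ?_ ?_)
      · rw [one_mul] at hprod'; exact hprod'
      · rw [one_mul] at hprod; exact hprod

/-- A system of equations over `D` that on a cube is solved by the top element only is a
conjunction computed by a counting circuit of polynomial size. -/
theorem exists_computesAND (hh : 2 ≤ h) (hprime : ∀ i, (p i).Prime)
    (halt : ∀ (i : ℕ) (hi : i + 1 < h), p ⟨i, Nat.lt_of_succ_lt hi⟩ ≠ p ⟨i + 1, hi⟩)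
    {P : ℕ} (hP : ∀ i, p i ≤ P) (Γ : DCircuit p) {m : ℕ}
    (x : (Fin m → Bool) → Γ.Input → DAlg p)
    (hx : ∀ i j (S : Submodule (ZMod (p j)) ((Fin m → Bool) → ZMod (p j))), 1 ∈ S →
      (∀ l, (fun y => if y l then 1 else 0) ∈ S) → (fun y => x y i j) ∈ S)
    (T : (Fin m → Bool) → DAlg p)
    (hT : ∀ j (S : Submodule (ZMod (p j)) ((Fin m → Bool) → ZMod (p j))), 1 ∈ S →
      (∀ k, (fun y => Γ.val (x y) k j) ∈ S) → (fun y => T y j) ∈ S)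
    (hAND : ∀ y, T y = 0 ↔ ∀ l, y l = true) :
    ∃ L : CCCircuit (List.ofFn p) m, L.ComputesAND ∧
      CCLayers.size L ≤ h * layerBound P Γ.size m + 1 := by
  set j : Fin h := ⟨0, by omega⟩ with hj
  obtain ⟨w, L, Z, hsize, hZ, hZL, -, -⟩ :=
    Γ.exists_layers hprime halt hP x hx T hT (h - 1) j (by simp only [hj]; omega)
  have hcons : List.ofFn p = p j :: (List.ofFn p).drop (j + 1) := by
    conv_lhs => rw [← List.drop_zero (l := List.ofFn p)]
    rw [List.drop_eq_getElem_cons (by simp; omega)]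
    simp [hj]
  have : NeZero (p j) := ⟨(hprime j).pos.ne'⟩
  obtain ⟨c, κ, hc⟩ := CCLayers.exists_coeff_of_mem_affineSpan hZL
  rw [hcons]
  -- The output gate tests `Z y = 0`, that is, whether the linear part of `Z` equals `-κ`.
  refine ⟨.layer (p j) 1 (fun _ => { mult := fun k => (c k).val, R := {-κ} }) L, fun y => ?_, ?_⟩
  · rw [← hAND, funext_iff]
    have hZ' : Z y = 0 ↔ ∀ i, T y i = 0 := by
      rw [hZ]
      exact forall_congr' fun i => imp_iff_right (by rw [Fin.le_def]; exact Nat.zero_le _)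
    refine Iff.trans ?_ hZ'
    simp only [CCLayers.eval, ModGate.eval, ZMod.natCast_val, ZMod.cast_id', id_eq,
      Set.mem_singleton_iff, decide_eq_true_eq, hc]
    rw [eq_neg_iff_add_eq_zero, add_comm]
  · simp only [CCLayers.size]
    have := Nat.mul_le_mul_right (layerBound P Γ.size m) (Nat.sub_le h 1)
    omega

end DCircuit

/-! ### Sparse sets and the density of solution sets -/

/-- If a subset `U` of a finite abelian group is sparse, then some combinatorial cube with top `a`
meets `U` in `a` at most. -/
theorem exists_cube_avoiding {G : Type*} [AddCommGroup G] [Fintype G] [DecidableEq G]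
    (U : Finset G) (a : G) (m : ℕ) (hU : 2 ^ m * U.card < Fintype.card G) :
    ∃ u : Fin m → G, ∀ y : Fin m → Bool,
      a + ∑ l, (if y l then 0 else u l) ∈ U → ∀ l, y l = true := by
  induction m with
  | zero => exact ⟨fun _ => 0, fun y _ l => l.elim0⟩
  | succ m ih =>
    obtain ⟨u, hu⟩ := ih (lt_of_le_of_lt
      (Nat.mul_le_mul_right _ (Nat.pow_le_pow_right two_pos (Nat.le_succ m))) hU)
    -- The forbidden directions: those that move some point of the cube built so far into `U`. There
    -- are at most 2^m |U| of them, hence not all of `G`.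
    let F : Finset G := Finset.univ.biUnion fun y : Fin m → Bool =>
      U.image fun z => z - (a + ∑ l, if y l then 0 else u l)
    have hF : F.card < Fintype.card G := by
      refine lt_of_le_of_lt Finset.card_biUnion_le (lt_of_le_of_lt (Finset.sum_le_sum
        fun y _ => Finset.card_image_le) ?_)
      simp only [Finset.sum_const, Finset.card_univ, Fintype.card_pi, Fintype.card_bool,
        Finset.prod_const, Fintype.card_fin, smul_eq_mul]
      exact lt_of_le_of_lt
        (Nat.mul_le_mul_right _ (Nat.pow_le_pow_right two_pos (Nat.le_succ m))) hU
    obtain ⟨v, hv⟩ : ∃ v, v ∉ F := by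
      by_contra! hall
      rw [Finset.eq_univ_iff_forall.mpr hall, Finset.card_univ] at hF
      exact lt_irrefl _ hF
    refine ⟨Fin.cons v u, fun y hy => ?_⟩
    rw [Fin.sum_univ_succ] at hy
    simp only [Fin.cons_zero, Fin.cons_succ] at hy
    have h0 : y 0 = true := by
      by_contra h0
      refine hv (Finset.mem_biUnion.mpr ⟨fun l => y l.succ, Finset.mem_univ _,
        Finset.mem_image.mpr ⟨_, hy, ?_⟩⟩)
      rw [if_neg h0]
      abel
    rw [if_pos h0, zero_add] at hy
    exact Fin.cases h0 (hu (fun l => y l.succ) hy)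

/-- Numerical form of the hypothesis `SESH`: with `2 ^ L` gates, conjunctions of length
`(B * L) ^ (h - 1)` are out of reach. -/
theorem SESH.exists_bound (sesh : SESH) {ps : List ℕ} (hlen : 2 ≤ ps.length)
    (hps : ∀ q ∈ ps, q.Prime) (hchain : ps.IsChain (· ≠ ·)) (C P : ℕ) :
    ∃ B : ℕ, 1 ≤ B ∧ ∀ L s : ℕ, 1 ≤ L → s ≤ 2 ^ L →
      ∀ Γ : CCCircuit ps ((B * L) ^ (ps.length - 1)), Γ.ComputesAND →
        C * (s + (B * L) ^ (ps.length - 1) + 1) ^ P < CCLayers.size Γ := by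
  obtain ⟨c, K, hc, hK, N, hN⟩ := sesh ps hlen hps hchain
  set e := ps.length - 1 with he
  have he1 : 1 ≤ e := by omega
  have hexp : ((ps.length : ℝ) - 1) = (e : ℝ) := by
    rw [he, Nat.cast_sub (by omega)]; simp
  have hlim : Filter.Tendsto (fun B : ℕ => (B : ℝ) ^ (e * P) / ((2 : ℝ) ^ c) ^ B) Filter.atTop
      (nhds 0) :=
    (isLittleO_pow_const_const_pow_of_one_lt (R := ℝ) (e * P)
      (Real.one_lt_rpow one_lt_two hc)).tendsto_div_nhds_zero
  have hM : 0 < K / ((C + 1) * 3 ^ P * 2 ^ (e * P)) := by positivity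
  -- Four demands on `B`: 2^(cB) beats the polynomial bound at L = 1, `B` is positive, the
  -- conjunctions have length at least `N`, and cB ≥ eP, so that for growing L the bound of SESH
  -- grows at least as fast as the polynomial one.
  obtain ⟨B, hB1, hB2, hB3, hB4⟩ := ((hlim.eventually (gt_mem_nhds hM)).and
    ((Filter.eventually_ge_atTop 1).and ((Filter.eventually_ge_atTop N).and
      (Filter.eventually_ge_atTop ⌈e * P / c⌉₊)))).exists
  refine ⟨B, hB2, fun L s hL hs Γ hΓ => ?_⟩
  have hBL : 1 ≤ B * L := Nat.mul_pos hB2 hL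
  have hm : N ≤ (B * L) ^ e :=
    hB3.trans ((Nat.le_mul_of_pos_right _ hL).trans (Nat.le_self_pow (by omega) _))
  have h1 := hN _ hm Γ hΓ
  rw [hexp, Nat.cast_pow, one_div, Real.pow_rpow_inv_natCast (by positivity) (by omega)] at h1
  have h2 : (s + (B * L) ^ e + 1 : ℕ) ≤ 3 * (B * 2 ^ L) ^ e := by
    have hL2 : L ≤ 2 ^ L := Nat.lt_two_pow_self.le
    have a1 : (B * L) ^ e ≤ (B * 2 ^ L) ^ e := Nat.pow_le_pow_left (Nat.mul_le_mul_left _ hL2) _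
    have a2 : s ≤ (B * 2 ^ L) ^ e :=
      hs.trans ((Nat.le_mul_of_pos_left _ hB2).trans (Nat.le_self_pow (by omega) _))
    have a3 : 1 ≤ (B * 2 ^ L) ^ e := Nat.pow_pos (Nat.mul_pos hB2 (by positivity))
    omega
  have h3 : C * (s + (B * L) ^ e + 1) ^ P ≤ C * (3 * (B * 2 ^ L) ^ e) ^ P :=
    Nat.mul_le_mul_left _ (Nat.pow_le_pow_left h2 _)
  refine lt_of_le_of_lt h3 ?_
  have h4 : ((C * (3 * (B * 2 ^ L) ^ e) ^ P : ℕ) : ℝ) < K * 2 ^ (c * ((B * L : ℕ) : ℝ)) := by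
    have hBc : (e * P : ℝ) ≤ c * B := by
      have := Nat.ceil_le.mp hB4
      rw [div_le_iff₀ hc] at this
      linarith
    rw [div_lt_div_iff₀ (by positivity) (by positivity)] at hB1
    have hL' : (1 : ℝ) ≤ L := by exact_mod_cast hL
    -- Splitting off the case L = 1 leaves exponentials in L - 1, which `hBc` compares.
    have h5 : (2 : ℝ) ^ (c * ((B * L : ℕ) : ℝ)) =
        (2 : ℝ) ^ (c * B) * 2 ^ (c * B * (L - 1)) := by
      rw [← Real.rpow_add two_pos]; congr 1; push_cast; ring
    have h6 : ((2 : ℝ) ^ L) ^ (e * P) = 2 ^ (e * P) * (2 : ℝ) ^ ((e * P : ℝ) * (L - 1)) := by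
      rw [← pow_mul, ← Real.rpow_natCast, ← Real.rpow_natCast, ← Real.rpow_add two_pos]
      congr 1; push_cast; ring
    have h7 : (2 : ℝ) ^ ((e * P : ℝ) * (L - 1)) ≤ 2 ^ (c * B * (L - 1)) :=
      Real.rpow_le_rpow_of_exponent_le one_le_two
        (mul_le_mul_of_nonneg_right hBc (by linarith))
    have h8 : ((2 : ℝ) ^ c) ^ B = 2 ^ (c * B) := by
      rw [← Real.rpow_natCast, ← Real.rpow_mul zero_le_two]
    rw [h8] at hB1
    have hpos : (0 : ℝ) < 2 ^ (c * B * (L - 1)) := by positivity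
    calc ((C * (3 * (B * 2 ^ L) ^ e) ^ P : ℕ) : ℝ)
        = C * 3 ^ P * (B : ℝ) ^ (e * P) * ((2 : ℝ) ^ L) ^ (e * P) := by
          push_cast
          rw [mul_pow, ← pow_mul, mul_pow]
          ring
      _ = (B : ℝ) ^ (e * P) * (C * 3 ^ P * 2 ^ (e * P)) * (2 : ℝ) ^ ((e * P : ℝ) * (L - 1)) := by
          rw [h6]; ring
      _ ≤ (B : ℝ) ^ (e * P) * ((C + 1) * 3 ^ P * 2 ^ (e * P)) * 2 ^ (c * B * (L - 1)) := by
          gcongr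
          linarith
      _ < K * 2 ^ (c * B) * 2 ^ (c * B * (L - 1)) := mul_lt_mul_of_pos_right hB1 hpos
      _ = K * 2 ^ (c * ((B * L : ℕ) : ℝ)) := by rw [h5]; ring
  exact_mod_cast h4.trans_le h1

namespace DCircuit

variable {h : ℕ} {p : Fin h → ℕ}

/-- The function `T` of the inputs of the circuit is coordinatewise an affine combination of
gates. -/
def IsAffineInGates (Γ : DCircuit p) (T : (Γ.Input → DAlg p) → DAlg p) : Prop :=
  ∀ (Y : Type) (x : Y → Γ.Input → DAlg p) (j : Fin h)
    (S : Submodule (ZMod (p j)) (Y → ZMod (p j))), 1 ∈ S →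
      (∀ k, (fun y => Γ.val (x y) k j) ∈ S) → (fun y => T (x y) j) ∈ S

theorem isAffineInGates_sub_const (Γ : DCircuit p) (k : Fin Γ.size) (d : DAlg p) :
    Γ.IsAffineInGates fun x => Γ.val x k - d := by
  intro Y x j S h1 hS
  convert S.sub_mem (hS k) (S.smul_mem (d j) h1) using 1
  funext y; simp

theorem isAffineInGates_sub_sub_const (Γ : DCircuit p) (k l : Fin Γ.size) (d : DAlg p) :
    Γ.IsAffineInGates fun x => Γ.val x k - Γ.val x l - d := by
  intro Y x j S h1 hS
  convert S.sub_mem (S.sub_mem (hS k) (hS l)) (S.smul_mem (d j) h1) using 1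
  funext y; simp

/-- A sparser solution set would leave room for a cube on which `T = 0` is a conjunction of length
`(B * L) ^ (h - 1)`, computed by a circuit smaller than SESH permits. -/
theorem exists_density_bound (sesh : SESH) (hh : 2 ≤ h) (hprime : ∀ i, (p i).Prime)
    (halt : ∀ (i : ℕ) (hi : i + 1 < h), p ⟨i, Nat.lt_of_succ_lt hi⟩ ≠ p ⟨i + 1, hi⟩) :
    ∃ B : ℕ, 1 ≤ B ∧ ∀ (Γ : DCircuit p) (L : ℕ), 1 ≤ L → Γ.size ≤ 2 ^ L →
      ∀ T : (Γ.Input → DAlg p) → DAlg p, Γ.IsAffineInGates T → (∃ x, T x = 0) →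
        Nat.card (Γ.Input → DAlg p) ≤ 2 ^ (B * L) ^ (h - 1) * Nat.card {x // T x = 0} := by
  classical
  have (i : Fin h) : NeZero (p i) := ⟨(hprime i).pos.ne'⟩
  set P := ∑ i, p i with hPdef
  have hP : ∀ i, p i ≤ P := fun i => Finset.single_le_sum (f := p) (fun _ _ => Nat.zero_le _)
    (Finset.mem_univ i)
  have hP1 : 1 ≤ P := (hprime ⟨0, by omega⟩).pos.trans_le (hP _)
  have hlen : (List.ofFn p).length = h := List.length_ofFn
  obtain ⟨B, hB, hbound⟩ := sesh.exists_bound (ps := List.ofFn p) (by rw [hlen]; exact hh)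
    (by simpa [List.mem_ofFn] using hprime)
    (by
      rw [List.isChain_iff_getElem]
      intro i hi
      rw [hlen] at hi
      simpa using halt i hi) (h * (P ^ P * P) + 1) P
  refine ⟨B, hB, fun Γ L hL hs T hT ⟨a, ha⟩ => ?_⟩
  rw [hlen] at hbound
  set m := (B * L) ^ (h - 1) with hm
  by_contra! hlt
  have hcard : Nat.card {x // T x = 0} = (Finset.univ.filter fun x => T x = 0).card := by
    rw [Nat.card_eq_fintype_card, Fintype.card_subtype]
  rw [hcard, Nat.card_eq_fintype_card] at hlt
  obtain ⟨u, hu⟩ := exists_cube_avoiding (Finset.univ.filter fun x => T x = 0) a m hlt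
  simp only [Finset.mem_filter, Finset.mem_univ, true_and] at hu
  let x : (Fin m → Bool) → Γ.Input → DAlg p := fun y => a + ∑ l, if y l then 0 else u l
  obtain ⟨Λ, hΛ, hsize⟩ := Γ.exists_computesAND hh hprime halt hP x
    (by
      intro i j S h1 hS
      have : (fun y => x y i j) =
          a i j • (1 : (Fin m → Bool) → ZMod (p j)) + ∑ l, (u l i j) •
            ((1 : (Fin m → Bool) → ZMod (p j)) - fun y => if y l then 1 else 0) := by
        funext y
        simp only [x, Pi.add_apply, Finset.sum_apply, Pi.smul_apply, Pi.one_apply, smul_eq_mul,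
          mul_one, Pi.sub_apply, add_right_inj]
        refine Finset.sum_congr rfl fun l _ => ?_
        split_ifs <;> simp
      rw [this]
      exact S.add_mem (S.smul_mem _ h1) (S.sum_mem fun l _ =>
        S.smul_mem _ (S.sub_mem h1 (hS l))))
    (fun y => T (x y)) (fun j S h1 hS => hT _ x j S h1 hS)
    (fun y => ⟨hu y, fun hy => by simp [x, hy, ha]⟩)
  refine absurd (hbound L Γ.size hL hs Λ hΛ) (not_lt.mpr (hsize.trans ?_))
  rw [layerBound, mul_pow]
  have : 1 ≤ (Γ.size + m + 1) ^ P := Nat.pow_pos (Nat.succ_pos _)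
  calc h * ((Γ.size + m + 1) ^ P * P ^ P * P) + 1
      = h * (P ^ P * P) * (Γ.size + m + 1) ^ P + 1 := by ring
    _ ≤ (h * (P ^ P * P) + 1) * (Γ.size + m + 1) ^ P := by rw [add_mul, one_mul]; omega

end DCircuit

/-! ### Total correctness and running time of machine programs -/

namespace RProg

/-- The program leads from `s` to `s'` in at most `T` steps. -/
def Steps (c : RProg) (s s' : RState) (T : ℕ) : Prop := ∃ t ≤ T, Exec c s s' t

theorem Steps.mono {c : RProg} {s s' : RState} {T T' : ℕ} (hc : Steps c s s' T) (hT : T ≤ T') :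
    Steps c s s' T' :=
  let ⟨t, ht, he⟩ := hc
  ⟨t, ht.trans hT, he⟩

theorem Steps.seq {c d : RProg} {s s' s'' : RState} {T T' : ℕ} (hc : Steps c s s' T)
    (hd : Steps d s' s'' T') : Steps (.seq c d) s s'' (T + T') :=
  let ⟨t, ht, he⟩ := hc
  let ⟨t', ht', he'⟩ := hd
  ⟨t + t', Nat.add_le_add ht ht', .seq he he'⟩

/-- A loop whose counter is decremented by every pass through its body. -/
theorem Steps.loop {c : RProg} {r T : ℕ} (I : ℕ → RState → Prop)
    (hr : ∀ n s, I n s → s.reg r = n)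
    (hI : ∀ n s, I (n + 1) s → ∃ s', Steps c s s' T ∧ I n s') (n : ℕ) (s : RState) (h : I n s) :
    ∃ s', Steps (.loop r c) s s' (n * (T + 1) + 1) ∧ I 0 s' := by
  induction n generalizing s with
  | zero => exact ⟨s, ⟨1, by simp, .loopStop (hr _ _ h)⟩, h⟩
  | succ n ih =>
    obtain ⟨s', ⟨t, ht, he⟩, h'⟩ := hI n s h
    obtain ⟨s'', ⟨t', ht', he'⟩, h''⟩ := ih s' h'
    refine ⟨s'', ⟨t + t' + 1, ?_, .loopStep (by rw [hr _ _ h]; omega) he he'⟩, h''⟩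
    rw [Nat.add_mul]; omega

/-- `f 0; f 1; …; f (n - 1)` -/
def iter (f : ℕ → RProg) : ℕ → RProg
  | 0 => .skip
  | n + 1 => .seq (iter f n) (f n)

theorem Steps.iter {f : ℕ → RProg} {T : ℕ} (I : ℕ → RState → Prop) (n : ℕ)
    (hI : ∀ i < n, ∀ s, I i s → ∃ s', Steps (f i) s s' T ∧ I (i + 1) s') (s : RState)
    (h : I 0 s) : ∃ s', Steps (RProg.iter f n) s s' (n * T + 1) ∧ I n s' := by
  induction n with
  | zero => exact ⟨s, ⟨1, by simp, .skip s⟩, h⟩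
  | succ n ih =>
    obtain ⟨s', hs', h'⟩ := ih fun i hi => hI i (Nat.lt_succ_of_lt hi)
    obtain ⟨s'', hs'', h''⟩ := hI n (Nat.lt_succ_self n) s' h'
    exact ⟨s'', (hs'.seq hs'').mono (by rw [Nat.add_mul]; omega), h''⟩

/-- `c₁; c₂; …; c_n` -/
def block : List RProg → RProg
  | [] => .skip
  | [c] => c
  | c :: l => .seq c (block l)

/-- Programs without loops. -/
def Straight : RProg → Prop
  | .seq c d => c.Straight ∧ d.Straight
  | .ite _ c d => c.Straight ∧ d.Straight
  | .loop _ _ => False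
  | _ => True

/-- The final state of a program without loops. -/
def run : RProg → RState → RState
  | .skip, s => s
  | .const r n, s => s.set r n
  | .add r a b, s => s.set r (s.reg a + s.reg b)
  | .sub r a b, s => s.set r (s.reg a - s.reg b)
  | .load r a, s => s.set r (s.mem (s.reg a))
  | .store a r, s => { s with mem := Function.update s.mem (s.reg a) (s.reg r) }
  | .flip r, s => { s.set r (if s.coins 0 then 1 else 0) with coins := fun i => s.coins (i + 1) }
  | .seq c d, s => d.run (c.run s)
  | .ite r c d, s => if s.reg r = 0 then d.run s else c.run s
  | .loop _ _, s => s

/-- A bound for the number of steps of a program without loops. -/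
def cost : RProg → ℕ
  | .seq c d => c.cost + d.cost
  | .ite _ c d => max c.cost d.cost + 1
  | _ => 1

theorem Straight.steps {c : RProg} (hc : c.Straight) (s : RState) : Steps c s (c.run s) c.cost := by
  induction c generalizing s with
  | skip => exact ⟨1, le_rfl, .skip s⟩
  | const r n => exact ⟨1, le_rfl, .const s r n⟩
  | add r a b => exact ⟨1, le_rfl, .add s r a b⟩
  | sub r a b => exact ⟨1, le_rfl, .sub s r a b⟩
  | load r a => exact ⟨1, le_rfl, .load s r a⟩
  | store a r => exact ⟨1, le_rfl, .store s a r⟩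
  | flip r => exact ⟨1, le_rfl, .flip s r⟩
  | seq c d ihc ihd => exact (ihc hc.1 s).seq (ihd hc.2 _)
  | ite r c d ihc ihd =>
    by_cases hr : s.reg r = 0
    · obtain ⟨t, ht, he⟩ := ihd hc.2 s
      refine ⟨t + 1, ?_, ?_⟩
      · simp only [cost]; omega
      · simp only [run, if_pos hr]; exact .iteFalse hr he
    · obtain ⟨t, ht, he⟩ := ihc hc.1 s
      refine ⟨t + 1, ?_, ?_⟩
      · simp only [cost]; omega
      · simp only [run, if_neg hr]; exact .iteTrue hr he
  | loop r c => exact hc.elim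

/-- `reg r := reg r + n * reg a` -/
theorem steps_iter_add {r a : ℕ} (hra : a ≠ r) (n : ℕ) (s : RState) :
    Steps (iter (fun _ => .add r r a) n) s (s.set r (s.reg r + n * s.reg a)) (n + 1) := by
  induction n with
  | zero =>
    have : s.set r (s.reg r + 0 * s.reg a) = s := by
      simp [RState.set]
    rw [this]; exact ⟨1, le_rfl, .skip s⟩
  | succ n ih =>
    have hs := ih.seq ⟨1, le_rfl, .add _ r r a⟩
    have heq : (s.set r (s.reg r + n * s.reg a)).set r
        ((s.set r (s.reg r + n * s.reg a)).reg r + (s.set r (s.reg r + n * s.reg a)).reg a)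
        = s.set r (s.reg r + (n + 1) * s.reg a) := by
      simp [RState.set, Function.update_of_ne hra, Nat.add_mul, Nat.add_assoc]
    rw [heq] at hs
    exact hs

end RProg

/-! ### Sampling and evaluating circuits on the machine -/

/-- Reduction modulo `q` of a number less than `2 * q`. -/
def reduceOnce (q z : ℕ) : ℕ := if q ≤ z then z - q else z

theorem reduceOnce_lt {q z : ℕ} (hz : z < 2 * q) : reduceOnce q z < q := by
  rw [reduceOnce]; split_ifs <;> omega

theorem cast_reduceOnce (q z : ℕ) : (reduceOnce q z : ZMod q) = z := by
  rw [reduceOnce]; split_ifs with h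
  · rw [Nat.cast_sub h]; simp
  · rfl

/-- The number with the binary digits `f 0, …, f (K - 1)`, the leading one first. -/
def binNum (f : ℕ → Bool) : ℕ → ℕ
  | 0 => 0
  | K + 1 => 2 * binNum f K + (if f K then 1 else 0)

/-- The residue modulo `q` of that number, as computed by the machine. -/
def binResidue (q : ℕ) (f : ℕ → Bool) : ℕ → ℕ
  | 0 => 0
  | K + 1 => reduceOnce q (2 * binResidue q f K + (if f K then 1 else 0))

theorem binResidue_lt {q : ℕ} (hq : 0 < q) (f : ℕ → Bool) (K : ℕ) : binResidue q f K < q := by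
  induction K with
  | zero => exact hq
  | succ K ih => rw [binResidue]; exact reduceOnce_lt (by split_ifs <;> omega)

theorem cast_binResidue (q : ℕ) (f : ℕ → Bool) (K : ℕ) :
    (binResidue q f K : ZMod q) = binNum f K := by
  induction K with
  | zero => rfl
  | succ K ih => rw [binResidue, binNum, cast_reduceOnce]; push_cast; rw [ih]

namespace RProg

/-- Toss `reg 4` coins and put the residue modulo `q` of the binary number obtained into the
register `12`. -/
def sampleResidue (q : ℕ) : RProg :=
  .seq (.seq (.const 12 0) (.add 11 4 23))
    (.loop 11 (block [.flip 18, .add 12 12 12, .add 12 12 18, .const 18 q, .add 19 12 1,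
      .sub 19 19 18, .ite 19 (.sub 12 12 18) .skip, .sub 11 11 1]))

/-- Register conventions: `1` holds 1, `23` holds 0 (adding it copies a register), `4` is the number
of coins per coordinate, `12` receives the result, `18` to `20` are scratch. With n tosses to go,
register `12` holds the residue of the number read from the first K - n coins. -/
theorem steps_sampleResidue (q : ℕ) (s : RState) (h1 : s.reg 1 = 1) (h23 : s.reg 23 = 0) :
    ∃ s', Steps (sampleResidue q) s s' (s.reg 4 * 10 + 3) ∧
      s'.reg 12 = binResidue q s.coins (s.reg 4) ∧ s'.mem = s.mem ∧
      (∀ i, s'.coins i = s.coins (s.reg 4 + i)) ∧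
      ∀ r, r ≠ 11 → r ≠ 12 → r ≠ 18 → r ≠ 19 → s'.reg r = s.reg r := by
  set K := s.reg 4 with hK
  set c := block [.flip 18, .add 12 12 12, .add 12 12 18, .const 18 q, .add 19 12 1,
      .sub 19 19 18, .ite 19 (.sub 12 12 18) .skip, .sub 11 11 1] with hc
  have hstraight : c.Straight := by simp [hc, block, Straight]
  obtain ⟨s', hs', -, h2, h3, h4, h5⟩ := Steps.loop (c := c) (r := 11) (T := 9)
    (fun n s' => s'.reg 11 = n ∧ s'.reg 12 = binResidue q s.coins (K - n) ∧ s'.mem = s.mem ∧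
      (∀ i, s'.coins i = s.coins (K - n + i)) ∧
      (∀ r, r ≠ 11 → r ≠ 12 → r ≠ 18 → r ≠ 19 → s'.reg r = s.reg r) ∧ n ≤ K)
    (fun n s' h => h.1)
    (by
      rintro n s' ⟨a1, a2, a3, a4, a5, a6⟩
      have b1 : s'.reg 1 = 1 := by rw [a5 1] <;> simp [h1]
      obtain ⟨d, hd⟩ : ∃ d, K = n + 1 + d := Nat.exists_eq_add_of_le a6
      have e1 : K - (n + 1) = d := by omega
      have e2 : K - n = d + 1 := by omega
      rw [e1] at a2 a4
      refine ⟨_, (hstraight.steps s').mono (by simp [hc, block, cost]), ?_⟩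
      have b2 : s'.coins 0 = s.coins d := by rw [a4]; rfl
      rw [e2]
      -- The machine decides q ≤ z by whether the truncated difference z + 1 - q is nonzero.
      by_cases hq : q ≤ 2 * binResidue q s.coins d + (if s.coins d then 1 else 0)
      · have hz : ¬ (2 * binResidue q s.coins d + (if s.coins d then 1 else 0) + 1 - q = 0) := by
          omega
        simp [hc, block, run, RState.set, b1, b2, a1, a2, hz, binResidue, reduceOnce, hq, ← two_mul]
        refine ⟨a3, fun i => ?_, ?_, by omega⟩
        · rw [a4]; congr 1; omega
        · intro r r1 r2 r3 r4; simp [*]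
      · have hz : 2 * binResidue q s.coins d + (if s.coins d then 1 else 0) + 1 - q = 0 := by
          omega
        simp [hc, block, run, RState.set, b1, b2, a1, a2, hz, binResidue, reduceOnce, hq, ← two_mul]
        refine ⟨a3, fun i => ?_, ?_, by omega⟩
        · rw [a4]; congr 1; omega
        · intro r r1 r2 r3 r4; simp [*])
    K (((RProg.const 12 0).seq (.add 11 4 23)).run s)
    (by
      simp [run, RState.set, h23, ← hK, binResidue]
      intro r r1 r2 r3 r4; simp [*])
  refine ⟨s', ((Straight.steps (c := (RProg.const 12 0).seq (.add 11 4 23))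
    (by simp [Straight]) s).seq hs').mono ?_, ?_⟩
  · simp [cost]; omega
  · exact ⟨h2, h3, h4, h5.1⟩

end RProg

/-- The value computed at the coordinate `j` modulo `q` for a gate of the given kind, from the
numbers in its record, the coordinates of its arguments, and a random residue. -/
def coordVal (q j kind a cst va vb vb' rnd : ℕ) : ℕ :=
  match kind with
  | 0 => rnd
  | 1 => cst
  | 2 => reduceOnce q (va + vb)
  | 3 => reduceOnce q (q - va)
  | 4 => if a = j then vb else 0
  | _ => if a = j then (if vb' = 0 then 0 else 1) else 0

namespace RProg

/-- Reduce the register `12` modulo the register `18`. -/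
def reduceReg : RProg :=
  block [.add 19 12 1, .sub 19 19 18, .ite 19 (.sub 12 12 18) .skip]

/-- Compute `coordVal` into the register `12`. -/
def dispatch : RProg :=
  .ite 13 (.seq (.sub 19 13 1) (.ite 19 (.seq (.sub 19 19 1) (.ite 19 (.seq (.sub 19 19 1)
    (.ite 19 (.seq (.sub 19 19 1) (.ite 19
      (block [.sub 20 14 28, .sub 19 28 14, .add 19 19 20,
        .ite 19 (.const 12 0) (.ite 27 (.const 12 1) (.const 12 0))])
      (block [.sub 20 14 28, .sub 19 28 14, .add 19 19 20,
        .ite 19 (.const 12 0) (.add 12 26 23)])))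
      (.seq (.sub 12 18 25) reduceReg)))
      (.seq (.add 12 25 26) reduceReg)))
      (.add 12 24 23))) .skip

theorem straight_dispatch : dispatch.Straight := by
  simp [dispatch, reduceReg, block, Straight]

theorem run_reduceReg (s : RState) (h1 : s.reg 1 = 1) :
    (reduceReg.run s).reg 12 = reduceOnce (s.reg 18) (s.reg 12) ∧
    (reduceReg.run s).mem = s.mem ∧ (reduceReg.run s).coins = s.coins ∧
    ∀ r, r ≠ 12 → r ≠ 19 → r ≠ 20 → (reduceReg.run s).reg r = s.reg r := by
  by_cases hq : s.reg 18 ≤ s.reg 12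
  · have hz : ¬ (s.reg 12 + 1 - s.reg 18 = 0) := by omega
    simp [reduceReg, block, run, RState.set, h1, hz, reduceOnce, hq]
    intro r r1 r2 r3; simp [*]
  · have hz : s.reg 12 + 1 - s.reg 18 = 0 := by omega
    simp [reduceReg, block, run, RState.set, h1, hz, reduceOnce, hq]
    intro r r1 r2 r3; simp [*]

theorem run_dispatch (s : RState) (h1 : s.reg 1 = 1) (h23 : s.reg 23 = 0) :
    (dispatch.run s).reg 12 = coordVal (s.reg 18) (s.reg 28) (s.reg 13) (s.reg 14) (s.reg 24)
      (s.reg 25) (s.reg 26) (s.reg 27) (s.reg 12) ∧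
    (dispatch.run s).mem = s.mem ∧ (dispatch.run s).coins = s.coins ∧
    ∀ r, r ≠ 12 → r ≠ 19 → r ≠ 20 → (dispatch.run s).reg r = s.reg r := by
  have hred := run_reduceReg
  rcases hk : s.reg 13 with _ | _ | _ | _ | _ | n
  · simp [dispatch, run, hk, coordVal]
  · simp [dispatch, run, hk, coordVal, RState.set, h1, h23]
    intro r r1 r2 r3; simp [*]
  · simp only [dispatch, run, hk, RState.set, h1]
    simp [h1]
    obtain ⟨e1, e2, e3, e4⟩ := hred ((RProg.add 12 25 26).run
      ((RProg.sub 19 19 1).run ((RProg.sub 19 13 1).run s))) (by simp [run, RState.set, h1])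
    simp [run, RState.set, h1, hk] at e1 e2 e3 e4
    refine ⟨e1, e2, e3, fun r r1 r2 r3 => ?_⟩
    rw [e4 r r1 r2 r3]; simp [*]
  · simp only [dispatch, run, hk, RState.set, h1]
    simp [h1]
    obtain ⟨e1, e2, e3, e4⟩ := hred ((RProg.sub 12 18 25).run ((RProg.sub 19 19 1).run
      ((RProg.sub 19 19 1).run ((RProg.sub 19 13 1).run s)))) (by simp [run, RState.set, h1])
    simp [run, RState.set, h1, hk] at e1 e2 e3 e4
    refine ⟨e1, e2, e3, fun r r1 r2 r3 => ?_⟩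
    rw [e4 r r1 r2 r3]; simp [*]
  · by_cases ha : s.reg 14 = s.reg 28
    · simp [dispatch, run, hk, coordVal, RState.set, h1, h23, block, ha]
      intro r r1 r2 r3; simp [*]
    · have : ¬ (s.reg 28 - s.reg 14 = 0 ∧ s.reg 14 - s.reg 28 = 0) := by omega
      simp only [dispatch, run, hk, coordVal, RState.set, h1, block]
      simp [h1, ha, this]
      intro r r1 r2 r3; simp [*]
  · by_cases ha : s.reg 14 = s.reg 28
    · by_cases hv : s.reg 27 = 0
      · simp [dispatch, run, hk, coordVal, RState.set, h1, block, ha, hv]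
        intro r r1 r2 r3; simp [*]
      · simp [dispatch, run, hk, coordVal, RState.set, h1, block, ha, hv]
        intro r r1 r2 r3; simp [*]
    · have : ¬ (s.reg 28 - s.reg 14 = 0 ∧ s.reg 14 - s.reg 28 = 0) := by omega
      simp only [dispatch, run, hk, coordVal, RState.set, h1, block]
      simp [h1, ha, this]
      intro r r1 r2 r3; simp [*]

/-- Compute the coordinate `j` of a gate and store it at the address in the register `9`. The
registers `8`, `16`, `17` hold the addresses of the record and of the arguments. -/
def coord (q j : ℕ) : RProg :=
  .seq (sampleResidue q) (.seq (block [.const 18 (3 + j), .add 18 8 18, .load 24 18,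
    .const 18 j, .add 18 16 18, .load 25 18, .const 18 j, .add 18 17 18, .load 26 18,
    .add 18 18 1, .load 27 18, .const 18 q, .const 28 j])
    (.seq dispatch (block [.store 9 12, .add 9 9 1])))

/-- Coins are tossed and all potential operands loaded whatever the kind of the gate, so every
coordinate consumes the same number of coins. At the last coordinate the cell `j + 1` belongs to
another gate; this is harmless, since no operation `v` has that index. -/
theorem steps_coord (q j : ℕ) (s : RState) (h1 : s.reg 1 = 1) (h23 : s.reg 23 = 0) :
    ∃ s', Steps (coord q j) s s' (s.reg 4 * 10 + 40) ∧ s'.reg 9 = s.reg 9 + 1 ∧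
      s'.mem = Function.update s.mem (s.reg 9) (coordVal q j (s.reg 13) (s.reg 14)
        (s.mem (s.reg 8 + (3 + j))) (s.mem (s.reg 16 + j)) (s.mem (s.reg 17 + j))
        (s.mem (s.reg 17 + j + 1)) (binResidue q s.coins (s.reg 4))) ∧
      (∀ i, s'.coins i = s.coins (s.reg 4 + i)) ∧
      ∀ r, r ≠ 9 → r ≠ 11 → r ≠ 12 → (r ≤ 17 ∨ 21 ≤ r ∧ r ≤ 23) → s'.reg r = s.reg r := by
  obtain ⟨s₁, hs₁, a1, a2, a3, a4⟩ := steps_sampleResidue q s h1 h23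
  set c := block [.const 18 (3 + j), .add 18 8 18, .load 24 18,
    .const 18 j, .add 18 16 18, .load 25 18, .const 18 j, .add 18 17 18, .load 26 18,
    .add 18 18 1, .load 27 18, .const 18 q, .const 28 j] with hc
  have hcs : c.Straight := by simp [hc, block, Straight]
  have b : ∀ r, r ≠ 18 → r ≠ 24 → r ≠ 25 → r ≠ 26 → r ≠ 27 → r ≠ 28 →
      (c.run s₁).reg r = s₁.reg r := by
    intro r r1 r2 r3 r4 r5 r6; simp [c, block, run, RState.set, *]
  have b1 : (c.run s₁).reg 1 = 1 := by rw [b 1, a4 1, h1] <;> simp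
  have b23 : (c.run s₁).reg 23 = 0 := by rw [b 23, a4 23, h23] <;> simp
  have bm : (c.run s₁).mem = s.mem := by simp [hc, block, run, RState.set, a2]
  have bc : (c.run s₁).coins = s₁.coins := by simp [hc, block, run, RState.set]
  have b18 : (c.run s₁).reg 18 = q := by simp [hc, block, run, RState.set]
  have b28 : (c.run s₁).reg 28 = j := by simp [hc, block, run, RState.set]
  have b24 : (c.run s₁).reg 24 = s.mem (s.reg 8 + (3 + j)) := by
    simp [hc, block, run, RState.set, a2, a4]
  have b25 : (c.run s₁).reg 25 = s.mem (s.reg 16 + j) := by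
    simp [hc, block, run, RState.set, a2, a4]
  have b26 : (c.run s₁).reg 26 = s.mem (s.reg 17 + j) := by
    simp [hc, block, run, RState.set, a2, a4]
  have b27 : (c.run s₁).reg 27 = s.mem (s.reg 17 + j + 1) := by
    simp [hc, block, run, RState.set, a2, a4, h1]
  obtain ⟨e1, e2, e3, e4⟩ := run_dispatch (c.run s₁) b1 b23
  rw [b18, b28, b24, b25, b26, b27, b 13, b 14, b 12, a4 13, a4 14, a1] at e1 <;> try simp
  set s₂ := dispatch.run (c.run s₁) with hs₂
  refine ⟨_, (hs₁.seq ((hcs.steps s₁).seq ((straight_dispatch.steps _).seq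
    (Straight.steps (c := block [.store 9 12, .add 9 9 1]) (by simp [block, Straight]) _)))).mono
    ?_, ?_⟩
  · have t1 : c.cost = 13 := by simp [hc, block, cost]
    have t2 : dispatch.cost ≤ 20 := by simp [dispatch, reduceReg, block, cost]
    have t3 : (block [.store 9 12, .add 9 9 1]).cost = 2 := by simp [block, cost]
    omega
  · rw [← hs₂]
    have e9 : s₂.reg 9 = s.reg 9 := by rw [e4, b, a4] <;> simp
    have e11 : s₂.reg 1 = 1 := by rw [e4, b1] <;> simp
    simp only [block, run, RState.set, e9, e11, e1, e2, bm, e3, bc, a3]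
    refine ⟨by simp, by simp, by simp, fun r r1 r2 r3 r4 => ?_⟩
    rw [Function.update_of_ne r1, e4, b, a4] <;> omega

end RProg

/-! ### Records of gates -/

theorem List.getD_flatten_of_length {α : Type*} (d : α) (n : ℕ) (l : List (List α))
    (hl : ∀ a ∈ l, a.length = n) (k i : ℕ) (hi : i < n) :
    l.flatten.getD (k * n + i) d = (l.getD k []).getD i d := by
  induction l generalizing k with
  | nil => simp
  | cons a l ih =>
    have ha : a.length = n := hl a (by simp)
    have hl' : ∀ b ∈ l, b.length = n := fun b hb => hl b (by simp [hb])
    rw [List.flatten_cons]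
    cases k with
    | zero => rw [List.getD_append _ _ _ _ (by omega)]; simp
    | succ k =>
      rw [List.getD_append_right _ _ _ _ (by rw [ha, Nat.add_mul]; omega), ha]
      have : (k + 1) * n + i - n = k * n + i := by rw [Nat.add_mul]; omega
      rw [this, ih hl']
      simp

theorem DGate.length_encode {h : ℕ} {p : Fin h → ℕ} {k : ℕ} (g : DGate p k) :
    g.encode.length = h + 3 := by
  cases g <;> simp [DGate.encode]

namespace DCircuit

variable {h : ℕ} {p : Fin h → ℕ}

theorem length_encode (Γ : DCircuit p) : Γ.encode.length = 3 + Γ.size * (h + 3) := by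
  simp only [encode, List.length_append, List.length_flatten, List.map_ofFn]
  have : (List.length ∘ fun k => (Γ.gate k).encode) = fun _ => h + 3 := by
    funext k; exact DGate.length_encode _
  rw [this]
  simp [List.ofFn_const]

theorem getD_encode (Γ : DCircuit p) (k : Fin Γ.size) (i : ℕ) (hi : i < h + 3) :
    Γ.encode.getD (3 + k * (h + 3) + i) 0 = (Γ.gate k).encode.getD i 0 := by
  rw [encode, List.getD_append_right _ _ _ _ (by simp; omega)]
  have : 3 + (k : ℕ) * (h + 3) + i - [Γ.size, (Γ.out₁ : ℕ), (Γ.out₂ : ℕ)].length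
      = k * (h + 3) + i := by simp; omega
  rw [this, List.getD_flatten_of_length _ _ _ _ _ _ hi]
  · congr 1
    rw [List.getD_eq_getElem _ _ (by simp)]
    simp
  · intro a ha
    obtain ⟨k, rfl⟩ := (List.mem_ofFn' _ _).mp ha
    exact DGate.length_encode _

/-- Every evaluated gate occupies `h` consecutive cells. An argument slot holding an index or
padding yields a meaningless address, but `coordVal` ignores the value found there. -/
theorem coordVal_gate (hp : ∀ i, 1 < p i) (Γ : DCircuit p) (x : Γ.Input → DAlg p)
    (k : Fin Γ.size) (j : Fin h) (mem : ℕ → ℕ) (b rnd : ℕ)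
    (hmem : ∀ (l : Fin Γ.size) (i : Fin h), l < k → mem (b + l * h + i) = (Γ.val x l i).val)
    (hrnd : ∀ hk : Γ.gate k = .input, rnd = (x ⟨k, hk⟩ j).val) :
    coordVal (p j) j ((Γ.gate k).encode.getD 0 0) ((Γ.gate k).encode.getD 1 0)
      ((Γ.gate k).encode.getD (3 + j) 0) (mem (b + h * (Γ.gate k).encode.getD 1 0 + j))
      (mem (b + h * (Γ.gate k).encode.getD 2 0 + j))
      (mem (b + h * (Γ.gate k).encode.getD 2 0 + j + 1)) rnd = (Γ.val x k j).val := by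
  have hval : ∀ (q n : ℕ) (z : ZMod q), n < q → (n : ZMod q) = z → n = z.val := by
    rintro q n _ hn rfl
    exact (ZMod.val_natCast_of_lt hn).symm
  have : NeZero (p j) := ⟨(Nat.zero_lt_of_lt (hp j)).ne'⟩
  have hm : ∀ (l : Fin k) (i : Fin h), mem (b + h * l + i)
      = (Γ.val x ⟨l, l.isLt.trans k.isLt⟩ i).val := fun l i => by
    rw [mul_comm]; exact hmem ⟨l, l.isLt.trans k.isLt⟩ i l.isLt
  rcases hg : Γ.gate k with _ | d | ⟨a, c⟩ | a | ⟨i, a⟩ | ⟨i, hi, a⟩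
  · rw [Γ.val_input x hg, ← hrnd hg]
    simp [DGate.encode, coordVal]
  · rw [Γ.val_const x hg]
    simp [DGate.encode, coordVal, add_comm 3]
  · rw [Γ.val_add x hg]
    simp only [DGate.encode, coordVal, List.cons_append, List.getD_cons_zero,
      List.getD_cons_succ, hm]
    refine hval _ _ _ (reduceOnce_lt ?_) ?_
    · rw [two_mul]; exact Nat.add_lt_add (ZMod.val_lt _) (ZMod.val_lt _)
    · rw [cast_reduceOnce]; push_cast; simp
  · rw [Γ.val_neg x hg]
    simp only [DGate.encode, coordVal, List.cons_append, List.getD_cons_zero,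
      List.getD_cons_succ, hm]
    refine hval _ _ _ (reduceOnce_lt ?_) ?_
    · have := hp j; omega
    · rw [cast_reduceOnce, Nat.cast_sub (ZMod.val_lt _).le]; simp
  · rw [Γ.val_e x hg]
    simp only [DGate.encode, coordVal, List.cons_append, List.getD_cons_zero,
      List.getD_cons_succ, hm]
    by_cases hij : i = j
    · subst hij; simp [DAlg.e]
    · have : (i : ℕ) ≠ j := fun e => hij (Fin.ext e)
      simp [DAlg.e, Pi.single_eq_of_ne (Ne.symm hij), this]
  · rw [Γ.val_v x hg]
    simp only [DGate.encode, coordVal, List.cons_append, List.getD_cons_zero,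
      List.getD_cons_succ]
    by_cases hij : i = j
    · have hj : (⟨i, Nat.lt_of_succ_lt hi⟩ : Fin h) = j := Fin.ext hij
      have h2 := hm a ⟨i + 1, hi⟩
      simp only at h2
      rw [if_pos hij, ← hij, add_assoc, h2]
      rw [← hj]
      simp only [DAlg.v, Pi.single_eq_same, ZMod.val_eq_zero]
      have := Fact.mk (hp ⟨i, Nat.lt_of_succ_lt hi⟩)
      split_ifs
      · simp
      · rw [ZMod.val_one]
    · have : (⟨i, Nat.lt_of_succ_lt hi⟩ : Fin h) ≠ j := fun e => hij (congrArg Fin.val e)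
      simp [DAlg.v, Pi.single_eq_of_ne (Ne.symm this), hij]

end DCircuit

/-- Uniqueness of division with remainder, which keeps apart the memory cells and, later, the coin
positions. -/
theorem mul_add_eq_mul_add_iff {h k l i j : ℕ} (hi : i < h) (hj : j < h) :
    k * h + i = l * h + j ↔ k = l ∧ i = j := by
  refine ⟨fun e => ?_, fun ⟨e, e'⟩ => by rw [e, e']⟩
  have hdiv : ∀ k i, i < h → (k * h + i) / h = k := fun k i hi => by
    rw [Nat.mul_comm, Nat.mul_add_div (Nat.zero_lt_of_lt hi), Nat.div_eq_of_lt hi, Nat.add_zero]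
  have hk : k = l := by rw [← hdiv k i hi, e, hdiv l j hj]
  subst hk
  exact ⟨rfl, by omega⟩

/-! ### Correctness of the evaluation in memory -/

namespace DCircuit

variable {h : ℕ} {p : Fin h → ℕ}

/-- The input that is sampled with `K` coins for every coordinate of every gate. -/
def sample (Γ : DCircuit p) (K : ℕ) (ω : ℕ → Bool) : Γ.Input → DAlg p :=
  fun k j => (binNum (fun t => ω ((k.val * h + j) * K + t)) K : ZMod (p j))

/-- The circuit is in the memory, and the auxiliary registers have their values. -/
structure Ready (Γ : DCircuit p) (s : RState) : Prop where
  one : s.reg 1 = 1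
  zero : s.reg 23 = 0
  base : s.reg 2 = Γ.encode.length
  size : s.reg 3 = Γ.size
  mem : ∀ z < Γ.encode.length, s.mem z = Γ.encode.getD z 0

/-- `i` coordinates of gates have been evaluated since the state `s₀`. -/
structure Evaluated (Γ : DCircuit p) (s₀ : RState) (i : ℕ) (s : RState) : Prop where
  frame : ∀ r, (1 ≤ r ∧ r ≤ 7 ∨ 21 ≤ r ∧ r ≤ 23) → s.reg r = s₀.reg r
  pos : s.reg 9 = Γ.encode.length + i
  mem : ∀ z < Γ.encode.length, s.mem z = Γ.encode.getD z 0
  val : ∀ (k : Fin Γ.size) (j : Fin h), k * h + j < i →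
    s.mem (Γ.encode.length + k * h + j) = (Γ.val (Γ.sample (s₀.reg 4) s₀.coins) k j).val
  coins : ∀ z, s.coins z = s₀.coins (i * s₀.reg 4 + z)

/-- The arguments of the gate `k` have been read. -/
structure Loaded (Γ : DCircuit p) (k : Fin Γ.size) (s : RState) : Prop where
  ptr : s.reg 8 = 3 + k * (h + 3)
  cnt : s.reg 10 = Γ.size - k
  kind : s.reg 13 = (Γ.gate k).encode.getD 0 0
  arg₁ : s.reg 14 = (Γ.gate k).encode.getD 1 0
  addr₁ : s.reg 16 = Γ.encode.length + h * (Γ.gate k).encode.getD 1 0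
  addr₂ : s.reg 17 = Γ.encode.length + h * (Γ.gate k).encode.getD 2 0

/-- The new cell lies just behind those already written, so the record of the gate and the values of
its arguments stay intact. -/
theorem steps_coord_evaluated (hp : ∀ i, 1 < p i) (Γ : DCircuit p) {s₀ : RState}
    (h₀ : Γ.Ready s₀) (k : Fin Γ.size) (j : Fin h) {s : RState}
    (hs : Γ.Evaluated s₀ (k * h + j) s) (hk : Γ.Loaded k s) :
    ∃ s', RProg.Steps (.coord (p j) j) s s' (s₀.reg 4 * 10 + 40) ∧
      Γ.Evaluated s₀ (k * h + (j + 1)) s' ∧ Γ.Loaded k s' := by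
  have f1 : s.reg 1 = 1 := by rw [hs.frame 1 (by omega), h₀.one]
  have f23 : s.reg 23 = 0 := by rw [hs.frame 23 (by omega), h₀.zero]
  have f4 : s.reg 4 = s₀.reg 4 := hs.frame 4 (by omega)
  obtain ⟨s', hsteps, a1, a2, a3, a4⟩ := RProg.steps_coord (p j) j s f1 f23
  rw [f4] at hsteps a2 a3
  refine ⟨s', hsteps, ⟨fun r hr => ?_, ?_, fun z hz => ?_, fun l i hli => ?_, fun z => ?_⟩, ?_⟩
  · rw [a4 r (by omega) (by omega) (by omega) (by omega)]
    exact hs.frame r hr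
  · rw [a1, hs.pos]; omega
  · rw [a2, Function.update_of_ne (by rw [hs.pos]; omega), hs.mem z hz]
  · rw [a2]
    by_cases heq : l.val * h + i = k * h + j
    · obtain ⟨e1, e2⟩ := (mul_add_eq_mul_add_iff i.isLt j.isLt).mp heq
      obtain rfl : l = k := Fin.ext e1
      obtain rfl : i = j := Fin.ext e2
      rw [hs.pos, ← Nat.add_assoc, Function.update_self, hk.kind, hk.arg₁, hk.addr₁, hk.addr₂,
        hk.ptr]
      have hrec : s.mem (3 + l * (h + 3) + (3 + i)) = (Γ.gate l).encode.getD (3 + i) 0 := by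
        have hlt : 3 + l.val * (h + 3) + (3 + i) < Γ.encode.length := by
          rw [length_encode]
          have := Nat.mul_le_mul_right (h + 3) (Nat.succ_le_of_lt l.isLt)
          rw [Nat.succ_mul] at this
          omega
        rw [hs.mem _ hlt, getD_encode _ _ _ (by omega)]
      rw [hrec]
      refine coordVal_gate hp Γ _ l i s.mem _ _ (fun l' i' hl => ?_) (fun hin => ?_)
      · refine hs.val l' i' ?_
        have := Nat.mul_le_mul_right h (Nat.succ_le_of_lt (Fin.lt_def.mp hl))
        rw [Nat.succ_mul] at this
        omega
      -- Exactly `s₀.reg 4` coins have been used per earlier coordinate, so the tosses now read are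
      -- the block that `sample` assigns to this coordinate.
      · have hb := binResidue_lt (Nat.zero_lt_of_lt (hp i)) s.coins (s₀.reg 4)
        rw [sample]
        rw [← ZMod.val_natCast_of_lt hb, cast_binResidue]
        congr 3
        funext t
        rw [hs.coins]
    · rw [Function.update_of_ne (by rw [hs.pos]; omega)]
      exact hs.val l i (by omega)
  · rw [a3, hs.coins]
    congr 1
    rw [← Nat.add_assoc (k.val * h), Nat.add_mul _ 1]
    omega
  · have e := fun r (h1 : r ≠ 9) (h2 : r ≠ 11) (h3 : r ≠ 12) (h4 : r ≤ 17) =>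
      a4 r h1 h2 h3 (Or.inl h4)
    constructor
    · rw [e] <;> first | exact hk.ptr | omega
    · rw [e] <;> first | exact hk.cnt | omega
    · rw [e] <;> first | exact hk.kind | omega
    · rw [e] <;> first | exact hk.arg₁ | omega
    · rw [e] <;> first | exact hk.addr₁ | omega
    · rw [e] <;> first | exact hk.addr₂ | omega

end DCircuit

namespace RProg

variable {h : ℕ} (p : Fin h → ℕ)

/-- Evaluate one gate; the register `8` holds the address of its record. -/
def gate : RProg :=
  .seq (block [.load 13 8, .add 18 8 1, .load 14 18, .add 18 18 1, .load 15 18, .add 16 2 23,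
    .add 17 2 23]) (.seq (iter (fun _ => .add 16 16 14) h) (.seq (iter (fun _ => .add 17 17 15) h)
    (.seq (iter (fun j => coord (if hj : j < h then p ⟨j, hj⟩ else 1) j) h)
      (block [.const 18 (h + 3), .add 8 8 18, .sub 10 10 1]))))

/-- Compare the coordinate `j` of the output gates. -/
def compare (j : ℕ) : RProg :=
  block [.const 18 j, .add 19 21 18, .load 19 19, .add 24 22 18, .load 24 24, .sub 25 19 24,
    .sub 26 24 19, .add 12 12 25, .add 12 12 26]

/-- Evaluate the circuit at random, and set the register `7` if the values of the output gates
are different (for `b = true`), or equal (for `b = false`). Decrement the register `6`. -/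
def trial (b : Bool) : RProg :=
  .seq (block [.const 8 3, .add 9 2 23, .add 10 3 23]) (.seq (.loop 10 (gate p))
    (.seq (.const 12 0) (.seq (iter compare h)
    (block [.ite 12 (if b then .const 7 1 else .skip) (if b then .skip else .const 7 1),
      .sub 6 6 1]))))

end RProg

namespace DCircuit

variable {h : ℕ} {p : Fin h → ℕ}

theorem steps_gate (hp : ∀ i, 1 < p i) (Γ : DCircuit p) {s₀ : RState} (h₀ : Γ.Ready s₀)
    (k : Fin Γ.size) {s : RState} (hs : Γ.Evaluated s₀ (k * h) s)
    (hptr : s.reg 8 = 3 + k * (h + 3)) (hcnt : s.reg 10 = Γ.size - k) :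
    ∃ s', RProg.Steps (.gate p) s s' (h * (s₀.reg 4 * 10 + 42) + 13) ∧
      Γ.Evaluated s₀ ((k + 1) * h) s' ∧ s'.reg 8 = 3 + (k + 1) * (h + 3) ∧
      s'.reg 10 = Γ.size - (k + 1) := by
  set c : RProg := .block [.load 13 8, .add 18 8 1, .load 14 18, .add 18 18 1, .load 15 18,
    .add 16 2 23, .add 17 2 23] with hc
  have hcs : c.Straight := by simp [hc, RProg.block, RProg.Straight]
  set s₁ := c.run s with hs₁
  have hrec : ∀ i < h + 3, s.mem (3 + k * (h + 3) + i) = (Γ.gate k).encode.getD i 0 := by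
    intro i hi
    have hlt : 3 + k.val * (h + 3) + i < Γ.encode.length := by
      rw [length_encode]
      have := Nat.mul_le_mul_right (h + 3) (Nat.succ_le_of_lt k.isLt)
      rw [Nat.succ_mul] at this
      omega
    rw [hs.mem _ hlt, getD_encode _ _ _ hi]
  have f1 : s.reg 1 = 1 := by rw [hs.frame 1 (by omega), h₀.one]
  have f23 : s.reg 23 = 0 := by rw [hs.frame 23 (by omega), h₀.zero]
  have f2 : s.reg 2 = Γ.encode.length := by rw [hs.frame 2 (by omega), h₀.base]
  have r0 := hrec 0 (by omega)
  have r1 := hrec 1 (by omega)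
  have r2 := hrec 2 (by omega)
  set s₂ := s₁.set 16 (s₁.reg 16 + h * s₁.reg 14) with hs₂
  set s₃ := s₂.set 17 (s₂.reg 17 + h * s₂.reg 15) with hs₃
  have e₁ : RProg.Steps (.iter (fun _ => .add 16 16 14) h) s₁ s₂ (h + 1) :=
    RProg.steps_iter_add (by decide) h s₁
  have e₂ : RProg.Steps (.iter (fun _ => .add 17 17 15) h) s₂ s₃ (h + 1) :=
    RProg.steps_iter_add (by decide) h s₂
  have hframe : ∀ r, (1 ≤ r ∧ r ≤ 12 ∨ 21 ≤ r ∧ r ≤ 23) → s₃.reg r = s.reg r := by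
    intro r hr
    have n1 : r ≠ 13 := by omega
    have n2 : r ≠ 14 := by omega
    have n3 : r ≠ 15 := by omega
    have n4 : r ≠ 16 := by omega
    have n5 : r ≠ 17 := by omega
    have n6 : r ≠ 18 := by omega
    simp [s₃, s₂, s₁, c, RProg.block, RProg.run, RState.set, *]
  have hmem : s₃.mem = s.mem := by
    simp [hs₃, hs₂, hs₁, hc, RProg.block, RProg.run, RState.set]
  have hcoins : s₃.coins = s.coins := by
    simp [hs₃, hs₂, hs₁, hc, RProg.block, RProg.run, RState.set]
  have hE : Γ.Evaluated s₀ (k * h + 0) s₃ := by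
    refine ⟨fun r hr => ?_, ?_, ?_, ?_, ?_⟩
    · rw [hframe r (by omega), hs.frame r hr]
    · rw [hframe 9 (by omega), hs.pos]; rfl
    · rw [hmem]; exact hs.mem
    · rw [hmem]; exact hs.val
    · rw [hcoins]; exact hs.coins
  have hL : Γ.Loaded k s₃ := by
    constructor
    · rw [hframe 8 (by omega), hptr]
    · rw [hframe 10 (by omega), hcnt]
    · rw [← r0]
      simp [hs₃, hs₂, hs₁, hc, RProg.block, RProg.run, RState.set, hptr]
    · rw [← r1]
      simp [hs₃, hs₂, hs₁, hc, RProg.block, RProg.run, RState.set, hptr, f1]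
    · rw [← r1]
      simp [hs₃, hs₂, hs₁, hc, RProg.block, RProg.run, RState.set, hptr, f1, f2, f23]
    · rw [← r2]
      simp [hs₃, hs₂, hs₁, hc, RProg.block, RProg.run, RState.set, hptr, f1, f2, f23, add_assoc]
  obtain ⟨s₄, e₃, hE', hL'⟩ := RProg.Steps.iter
    (f := fun j => .coord (if hj : j < h then p ⟨j, hj⟩ else 1) j) (T := s₀.reg 4 * 10 + 40)
    (fun j s => Γ.Evaluated s₀ (k * h + j) s ∧ Γ.Loaded k s) h
    (fun j hj s hjs => by
      simp only [dif_pos hj]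
      exact Γ.steps_coord_evaluated hp h₀ k ⟨j, hj⟩ hjs.1 hjs.2) s₃ ⟨hE, hL⟩
  set d : RProg := .block [.const 18 (h + 3), .add 8 8 18, .sub 10 10 1] with hd
  have hds : d.Straight := by simp [hd, RProg.block, RProg.Straight]
  refine ⟨_, ((hcs.steps s).seq (e₁.seq (e₂.seq (e₃.seq (hds.steps s₄))))).mono ?_, ?_, ?_, ?_⟩
  · have t1 : c.cost = 7 := by simp [hc, RProg.block, RProg.cost]
    have t2 : d.cost = 3 := by simp [hd, RProg.block, RProg.cost]
    have t3 : h * (s₀.reg 4 * 10 + 42) = h * (s₀.reg 4 * 10 + 40) + h * 2 := by ring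
    omega
  · have hh : (k.val + 1) * h = k * h + h := by rw [Nat.add_mul, Nat.one_mul]
    rw [hh]
    refine ⟨fun r hr => ?_, ?_, ?_, ?_, ?_⟩
    · rw [← hE'.frame r hr]
      have n1 : r ≠ 8 := by omega
      have n2 : r ≠ 10 := by omega
      have n3 : r ≠ 18 := by omega
      simp [d, RProg.block, RProg.run, RState.set, *]
    · rw [← hE'.pos]
      simp [hd, RProg.block, RProg.run, RState.set]
    · intro z hz
      rw [← hE'.mem z hz]
      simp [hd, RProg.block, RProg.run, RState.set]
    · intro l i hli
      rw [← hE'.val l i hli]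
      simp [hd, RProg.block, RProg.run, RState.set]
    · intro z
      rw [← hE'.coins z]
      simp [hd, RProg.block, RProg.run, RState.set]
  · simp [hd, RProg.block, RProg.run, RState.set, hL'.ptr]
    ring
  · have g1 : s₄.reg 1 = 1 := by rw [hE'.frame 1 (by omega), h₀.one]
    simp [hd, RProg.block, RProg.run, RState.set, hL'.cnt, g1]
    omega

/-- The outcome of a trial. -/
def TrialSucceeds (Γ : DCircuit p) (b : Bool) (K : ℕ) (ω : ℕ → Bool) : Prop :=
  (Γ.val (Γ.sample K ω) Γ.out₁ ≠ Γ.val (Γ.sample K ω) Γ.out₂) ↔ b = true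

-- Register `12` adds up the truncated differences in both directions, hence stays 0 exactly when
-- the outputs agree. The number of coins used does not depend on the outcome, so successive trials
-- read disjoint blocks. Register `7` is never reset.
open Classical in
theorem steps_trial (hp : ∀ i, 1 < p i) (Γ : DCircuit p) (b : Bool) {s₀ : RState}
    (h₀ : Γ.Ready s₀) (h21 : s₀.reg 21 = Γ.encode.length + h * Γ.out₁)
    (h22 : s₀.reg 22 = Γ.encode.length + h * Γ.out₂) :
    ∃ s', RProg.Steps (.trial p b) s₀ s'
        (Γ.size * (h * (s₀.reg 4 * 10 + 42) + 14) + h * 9 + 10) ∧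
      Γ.Ready s' ∧ (∀ r, (4 ≤ r ∧ r ≤ 5 ∨ 21 ≤ r ∧ r ≤ 22) → s'.reg r = s₀.reg r) ∧
      s'.reg 6 = s₀.reg 6 - 1 ∧
      s'.reg 7 = (if Γ.TrialSucceeds b (s₀.reg 4) s₀.coins then 1 else s₀.reg 7) ∧
      ∀ z, s'.coins z = s₀.coins (Γ.size * h * s₀.reg 4 + z) := by
  set c : RProg := .block [.const 8 3, .add 9 2 23, .add 10 3 23] with hc
  have hcs : c.Straight := by simp [hc, RProg.block, RProg.Straight]
  obtain ⟨s₁, e₁, E₁⟩ := RProg.Steps.loop (r := 10) (c := .gate p)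
    (T := h * (s₀.reg 4 * 10 + 42) + 13)
    (fun n s => ∃ k, k + n = Γ.size ∧ s.reg 10 = n ∧ s.reg 8 = 3 + k * (h + 3) ∧
      Γ.Evaluated s₀ (k * h) s)
    (fun n s hs => hs.choose_spec.2.1)
    (by
      rintro n s ⟨k, hk, h10, h8, hE⟩
      obtain ⟨s', hs', hE', h8', h10'⟩ := Γ.steps_gate hp h₀ ⟨k, by omega⟩ hE h8
        (by simp only; omega)
      exact ⟨s', hs', k + 1, by omega, by simp only at h10'; omega, h8', hE'⟩)
    Γ.size (c.run s₀)
    (by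
      refine ⟨0, by omega, ?_, ?_, ?_, ?_, ?_, ?_, ?_⟩
      · simp [hc, RProg.block, RProg.run, RState.set, h₀.zero, h₀.size]
      · simp [hc, RProg.block, RProg.run, RState.set]
      · intro r hr
        have n1 : r ≠ 8 := by omega
        have n2 : r ≠ 9 := by omega
        have n3 : r ≠ 10 := by omega
        simp [c, RProg.block, RProg.run, RState.set, *]
      · simp [hc, RProg.block, RProg.run, RState.set, h₀.zero, h₀.base]
      · intro z hz
        rw [← h₀.mem z hz]
        simp [hc, RProg.block, RProg.run, RState.set]
      · intro k j hkj; omega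
      · intro z; simp [hc, RProg.block, RProg.run, RState.set])
  obtain ⟨k, hk, -, -, hE⟩ := E₁
  rw [Nat.add_zero] at hk
  subst hk
  set x := Γ.sample (s₀.reg 4) s₀.coins with hx
  have hval : ∀ (k : Fin Γ.size) (j : Fin h),
      s₁.mem (Γ.encode.length + k * h + j) = (Γ.val x k j).val := by
    intro k j
    refine hE.val k j ?_
    have := Nat.mul_le_mul_right h (Nat.succ_le_of_lt k.isLt)
    rw [Nat.succ_mul] at this
    omega
  set s₂ := (RProg.const 12 0).run s₁ with hs₂
  obtain ⟨s₃, e₃, hmem, hcoins, hframe, hacc⟩ := RProg.Steps.iter (f := RProg.compare) (T := 9)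
    (fun j s => s.mem = s₁.mem ∧ s.coins = s₁.coins ∧
      (∀ r, (1 ≤ r ∧ r ≤ 7 ∨ 21 ≤ r ∧ r ≤ 23) → s.reg r = s₁.reg r) ∧
      (s.reg 12 = 0 ↔ ∀ i : Fin h, i < j → Γ.val x Γ.out₁ i = Γ.val x Γ.out₂ i)) h
    (by
      rintro j hj s ⟨a1, a2, a3, a4⟩
      have hstr : (RProg.compare j).Straight := by
        simp [RProg.compare, RProg.block, RProg.Straight]
      refine ⟨_, (hstr.steps s).mono (by simp [RProg.compare, RProg.block, RProg.cost]),
        ?_, ?_, ?_, ?_⟩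
      · simp [RProg.compare, RProg.block, RProg.run, RState.set, a1]
      · simp [RProg.compare, RProg.block, RProg.run, RState.set, a2]
      · intro r hr
        rw [← a3 r hr]
        have n1 : r ≠ 12 := by omega
        have n2 : r ≠ 18 := by omega
        have n3 : r ≠ 19 := by omega
        have n4 : r ≠ 24 := by omega
        have n5 : r ≠ 25 := by omega
        have n6 : r ≠ 26 := by omega
        simp [RProg.compare, RProg.block, RProg.run, RState.set, *]
      · have b21 : s.reg 21 = Γ.encode.length + Γ.out₁ * h := by
          rw [a3 21 (by omega), hE.frame 21 (by omega), h21, mul_comm]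
        have b22 : s.reg 22 = Γ.encode.length + Γ.out₂ * h := by
          rw [a3 22 (by omega), hE.frame 22 (by omega), h22, mul_comm]
        have v1 := hval Γ.out₁ ⟨j, hj⟩
        have v2 := hval Γ.out₂ ⟨j, hj⟩
        simp only at v1 v2
        have : NeZero (p ⟨j, hj⟩) := ⟨(Nat.zero_lt_of_lt (hp _)).ne'⟩
        have hall : (∀ i : Fin h, i.val < j + 1 → Γ.val x Γ.out₁ i = Γ.val x Γ.out₂ i) ↔
            s.reg 12 = 0 ∧ Γ.val x Γ.out₁ ⟨j, hj⟩ = Γ.val x Γ.out₂ ⟨j, hj⟩ := by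
          rw [a4]
          refine ⟨fun H => ⟨fun i hi => H i (by omega), H _ (Nat.lt_succ_self j)⟩, fun H i hi => ?_⟩
          rcases Nat.lt_succ_iff_lt_or_eq.mp hi with hlt | heq
          · exact H.1 i hlt
          · obtain rfl : i = ⟨j, hj⟩ := Fin.ext heq
            exact H.2
        rw [hall, ← (ZMod.val_injective (p ⟨j, hj⟩)).eq_iff, ← v1, ← v2]
        simp [RProg.compare, RProg.block, RProg.run, RState.set, a1, b21, b22]
        omega)
    s₂
    (by
      refine ⟨rfl, rfl, fun r hr => ?_, ?_⟩
      · have n1 : r ≠ 12 := by omega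
        simp [hs₂, RProg.run, RState.set, n1]
      · simp [hs₂, RProg.run, RState.set])
  have hacc' : s₃.reg 12 = 0 ↔ Γ.val x Γ.out₁ = Γ.val x Γ.out₂ := by
    rw [hacc, funext_iff]
    exact forall_congr' fun i => imp_iff_right i.isLt
  set d : RProg := .block [.ite 12 (if b then .const 7 1 else .skip)
    (if b then .skip else .const 7 1), .sub 6 6 1] with hd
  have hds : d.Straight := by cases b <;> simp [hd, RProg.block, RProg.Straight]
  have dr : ∀ r, r ≠ 6 → r ≠ 7 → (d.run s₃).reg r = s₃.reg r := by
    intro r r1 r2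
    cases b <;> simp [hd, RProg.block, RProg.run, RState.set, r1] <;> split_ifs <;> simp [r2]
  have dm : (d.run s₃).mem = s₃.mem := by
    cases b <;> simp [hd, RProg.block, RProg.run, RState.set] <;> split_ifs <;> simp
  have dc : (d.run s₃).coins = s₃.coins := by
    cases b <;> simp [hd, RProg.block, RProg.run, RState.set] <;> split_ifs <;> simp
  have fr : ∀ r, (1 ≤ r ∧ r ≤ 7 ∨ 21 ≤ r ∧ r ≤ 23) → s₃.reg r = s₀.reg r := fun r hr => by
    rw [hframe r hr, hE.frame r hr]
  have g1 : s₃.reg 1 = 1 := by rw [fr 1 (by omega), h₀.one]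
  refine ⟨_, ((hcs.steps s₀).seq (e₁.seq ((RProg.Straight.steps (c := .const 12 0) trivial s₁).seq (e₃.seq
    (hds.steps s₃))))).mono ?_, ⟨?_, ?_, ?_, ?_, ?_⟩, fun r hr => ?_, ?_, ?_, fun z => ?_⟩
  · have t1 : c.cost = 3 := by simp [hc, RProg.block, RProg.cost]
    have t2 : d.cost = 3 := by cases b <;> simp [hd, RProg.block, RProg.cost]
    have t3 : (RProg.const 12 0).cost = 1 := rfl
    have t4 : h * (s₀.reg 4 * 10 + 42) + 13 + 1 = h * (s₀.reg 4 * 10 + 42) + 14 := rfl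
    rw [t1, t2, t3, t4]
    omega
  · rw [dr 1 (by omega) (by omega), g1]
  · rw [dr 23 (by omega) (by omega), fr 23 (by omega), h₀.zero]
  · rw [dr 2 (by omega) (by omega), fr 2 (by omega), h₀.base]
  · rw [dr 3 (by omega) (by omega), fr 3 (by omega), h₀.size]
  · rw [dm, hmem]; exact hE.mem
  · rw [dr r (by omega) (by omega), fr r (by omega)]
  · rw [← fr 6 (by omega)]
    cases b <;> simp [hd, RProg.block, RProg.run, RState.set] <;> split_ifs <;> simp [g1]
  · rw [← fr 7 (by omega), TrialSucceeds, ← hx, ne_eq, ← hacc']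
    cases b <;> by_cases hz : s₃.reg 12 = 0 <;> simp [hd, RProg.block, RProg.run, RState.set, hz]
  · rw [dc, hcoins, hE.coins]

end DCircuit

/-! ### Number of trials and the search program -/

namespace RProg

/-- Double the register `6` as often as the `e`-th power of the register `29` says. -/
def powLoop : ℕ → RProg
  | 0 => .add 6 6 6
  | e + 1 => .seq (.add (30 + e) 29 23) (.loop (30 + e) (.seq (powLoop e) (.sub (30 + e) (30 + e) 1)))

/-- In the absence of multiplication, 2^(N^e) comes from doubling inside e nested loops of N rounds,
each level having its own counter from register `30` on. The factor 8 per level absorbs the overhead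
because N ≥ 1. -/
theorem steps_powLoop (e : ℕ) (s : RState) (h1 : s.reg 1 = 1) (h23 : s.reg 23 = 0)
    (h29 : 1 ≤ s.reg 29) :
    ∃ s', Steps (powLoop e) s s' ((8 * s.reg 29) ^ e) ∧
      s'.reg 6 = s.reg 6 * 2 ^ s.reg 29 ^ e ∧ s'.mem = s.mem ∧ s'.coins = s.coins ∧
      ∀ r, r ≠ 6 → (r < 30 ∨ 30 + e ≤ r) → s'.reg r = s.reg r := by
  induction e generalizing s with
  | zero =>
    refine ⟨_, ⟨1, by simp, .add s 6 6 6⟩, ?_, rfl, rfl, fun r hr _ => ?_⟩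
    · simp [RState.set, mul_two]
    · simp [RState.set, hr]
  | succ e ih =>
    set N := s.reg 29 with hN
    obtain ⟨s', hs', -, a1, a2, a3, a4, a5⟩ := Steps.loop (r := 30 + e)
      (c := .seq (powLoop e) (.sub (30 + e) (30 + e) 1)) (T := (8 * N) ^ e + 1)
      (fun n s' => s'.reg (30 + e) = n ∧ n ≤ N ∧ s'.reg 6 = s.reg 6 * 2 ^ ((N - n) * N ^ e) ∧
        s'.mem = s.mem ∧ s'.coins = s.coins ∧
        ∀ r, r ≠ 6 → (r < 30 ∨ 30 + e < r) → s'.reg r = s.reg r)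
      (fun n s' hs' => hs'.1)
      (by
        rintro n s' ⟨a0, a1, a2, a3, a4, a5⟩
        have f29 : s'.reg 29 = N := a5 29 (by omega) (by omega)
        have f1 : s'.reg 1 = 1 := by rw [a5 1 (by omega) (by omega), h1]
        obtain ⟨s'', hs'', b1, b2, b3, b4⟩ := ih s' f1
          (by rw [a5 23 (by omega) (by omega), h23]) (by rw [f29]; exact h29)
        rw [f29] at hs'' b1
        have f1' : s''.reg 1 = 1 := by rw [b4 1 (by omega) (by omega), f1]
        have fe : s''.reg (30 + e) = n + 1 := by rw [b4 _ (by omega) (by omega), a0]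
        refine ⟨_, hs''.seq ⟨1, le_rfl, .sub _ _ _ _⟩, ?_, by omega, ?_, ?_, ?_, ?_⟩
        · simp [RState.set, f1', fe]
        · have h6 : 6 ≠ 30 + e := by omega
          simp only [RState.set, Function.update_of_ne h6]
          obtain ⟨d, hd⟩ : ∃ d, N = n + 1 + d := Nat.exists_eq_add_of_le a1
          have e1 : N - (n + 1) = d := by omega
          have e2 : N - n = d + 1 := by omega
          rw [b1, a2, e1, e2, mul_assoc, ← pow_add]
          ring
        · simp [RState.set, b2, a3]
        · simp [RState.set, b3, a4]
        · intro r hr hr'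
          have hre : r ≠ 30 + e := by omega
          simp only [RState.set, Function.update_of_ne hre]
          rw [b4 r hr (by omega), a5 r hr hr'])
      N ((RProg.add (30 + e) 29 23).run s)
      (by
        refine ⟨by simp [run, RState.set, h23, ← hN], le_rfl, ?_, rfl, rfl, fun r hr hr' => ?_⟩
        · have h6 : 6 ≠ 30 + e := by omega
          simp [run, RState.set, Function.update_of_ne h6]
        · have hre : r ≠ 30 + e := by omega
          simp [run, RState.set, Function.update_of_ne hre])
    refine ⟨s', ((Straight.steps (c := .add (30 + e) 29 23) trivial s).seq hs').mono ?_, ?_, a3, a4,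
      fun r hr hr' => a5 r hr (by omega)⟩
    · have hc : (RProg.add (30 + e) 29 23).cost = 1 := rfl
      rw [hc, pow_succ]
      have hX : 1 ≤ (8 * N) ^ e := Nat.pow_pos (by omega)
      have hX' : N * 1 ≤ N * (8 * N) ^ e := Nat.mul_le_mul_left N hX
      have : (8 * N) ^ e * (8 * N) = 8 * (N * (8 * N) ^ e) := by ring
      rw [this, Nat.mul_add, Nat.mul_add]
      omega
    · rw [a2, Nat.sub_zero, pow_succ N e, mul_comm (N ^ e)]

/-- The program that estimates the logarithm of the size. -/
def logLoop : RProg :=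
  .loop 10 (block [.sub 19 3 18, .ite 19 (block [.add 18 18 18, .add 5 5 1]) .skip, .sub 10 10 1])

/-- A power of two is doubled until it reaches the size S. As each doubling adds at least 1, S
rounds are enough; the invariant `l = 0 ∨ 2 ^ l < 2 * S` makes the exponent minimal. -/
theorem steps_logLoop (s : RState) (h1 : s.reg 1 = 1) (h5 : s.reg 5 = 1)
    (h18 : s.reg 18 = 1) (h10 : s.reg 10 = s.reg 3) :
    ∃ s', Steps logLoop s s' (s.reg 3 * 6 + 1) ∧ s'.reg 5 = Nat.clog 2 (s.reg 3) + 1 ∧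
      s'.mem = s.mem ∧ s'.coins = s.coins ∧
      ∀ r, r ≠ 5 → r ≠ 10 → r ≠ 18 → r ≠ 19 → s'.reg r = s.reg r := by
  set c := block [.sub 19 3 18, .ite 19 (block [.add 18 18 18, .add 5 5 1]) .skip, .sub 10 10 1]
    with hc
  have hcs : c.Straight := by simp [hc, block, Straight]
  set S := s.reg 3 with hS
  obtain ⟨s', hs', -, l, a1, a2, a3, a4, a5, a6, a7⟩ := Steps.loop (r := 10) (c := c) (T := 5)
    (fun n s' => s'.reg 10 = n ∧ ∃ l, s'.reg 5 = l + 1 ∧ s'.reg 18 = 2 ^ l ∧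
      (S ≤ 2 ^ l ∨ S < 2 ^ l + n) ∧ (l = 0 ∨ 2 ^ l < 2 * S) ∧ s'.mem = s.mem ∧
      s'.coins = s.coins ∧ ∀ r, r ≠ 5 → r ≠ 10 → r ≠ 18 → r ≠ 19 → s'.reg r = s.reg r)
    (fun n s' hs' => hs'.1)
    (by
      rintro n s' ⟨a0, l, a1, a2, a3, a4, a5, a6, a7⟩
      have f1 : s'.reg 1 = 1 := by rw [a7 1, h1] <;> omega
      have f3 : s'.reg 3 = S := by rw [a7 3] <;> omega
      refine ⟨_, (hcs.steps s').mono (by simp [hc, block, cost]), ?_⟩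
      have hpos : 0 < 2 ^ l := Nat.two_pow_pos l
      by_cases hl : S ≤ 2 ^ l
      · have hz : S - 2 ^ l = 0 := by omega
        refine ⟨?_, l, ?_, ?_, Or.inl hl, a4, ?_, ?_, fun r r1 r2 r3 r4 => ?_⟩
        · simp [hc, block, run, RState.set, f1, f3, a0, a2, hz]
        · simp [hc, block, run, RState.set, f3, a1, a2, hz]
        · simp [hc, block, run, RState.set, f3, a2, hz]
        · simp [hc, block, run, RState.set, f3, a2, hz, a5]
        · simp [hc, block, run, RState.set, f3, a2, hz, a6]
        · rw [← a7 r r1 r2 r3 r4]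
          simp [c, block, run, RState.set, f3, a2, hz, r2, r4]
      · have hz : ¬ S ≤ 2 ^ l := hl
        have hz' : S - 2 ^ l ≠ 0 := by omega
        refine ⟨?_, l + 1, ?_, ?_, Or.inr ?_, Or.inr ?_, ?_, ?_, fun r r1 r2 r3 r4 => ?_⟩
        · simp [hc, block, run, RState.set, f1, f3, a0, a2, hz']
        · simp [hc, block, run, RState.set, f1, f3, a1, a2, hz']
        · simp [hc, block, run, RState.set, f3, a2, hz', pow_succ, mul_two]
        · rw [pow_succ]; omega
        · rw [pow_succ]; omega
        · simp [hc, block, run, RState.set, f3, a2, hz', a5]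
        · simp [hc, block, run, RState.set, f3, a2, hz', a6]
        · rw [← a7 r r1 r2 r3 r4]
          simp [c, block, run, RState.set, f3, a2, hz', r1, r2, r3, r4])
    S s
    ⟨h10, 0, h5, by simp [h18], by simp, Or.inl rfl, rfl, rfl, fun r _ _ _ _ => rfl⟩
  refine ⟨s', hs', ?_, a5, a6, a7⟩
  rw [a1, Nat.add_right_cancel_iff]
  have hle : S ≤ 2 ^ l := by omega
  refine le_antisymm ?_ (Nat.clog_le_of_le_pow hle)
  rcases a4 with h0 | h0
  · omega
  · rcases l with _ | l
    · omega
    · rw [pow_succ] at h0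
      exact Nat.succ_le_of_lt ((Nat.lt_clog_iff_pow_lt one_lt_two).mpr (by omega))

variable {h : ℕ} (p : Fin h → ℕ)

/-- The initialisation: read the size and the output gates, and compute the numbers of coins and
of trials. -/
def setup (h B K₀ : ℕ) : RProg :=
  .seq (block [.const 1 1, .add 2 0 23, .load 3 23, .load 14 1, .const 18 2, .load 15 18,
    .add 21 2 23, .add 22 2 23]) (.seq (iter (fun _ => .add 21 21 14) h)
  (.seq (iter (fun _ => .add 22 22 15) h) (.seq (block [.const 4 K₀, .add 4 4 3, .const 5 1,
    .const 18 1, .add 10 3 23]) (.seq logLoop (.seq (.const 29 0)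
  (.seq (iter (fun _ => .add 29 29 5) B) (.seq (.const 6 2) (powLoop (h - 1)))))))))

/-- The probabilistic algorithm: evaluate the circuit at random inputs, and look for one where the
output gates are different (for `b = true`), or equal (for `b = false`). -/
def search (b : Bool) (B K₀ : ℕ) : RProg :=
  .seq (setup h B K₀) (.seq (.loop 6 (trial p b)) (if b then .sub 0 1 7 else .add 0 7 23))

end RProg

namespace DCircuit

variable {h : ℕ} {p : Fin h → ℕ}

/-- An upper estimate of the binary logarithm of the size. -/
def logSize (Γ : DCircuit p) : ℕ := Nat.clog 2 Γ.size + 1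

theorem size_pos (Γ : DCircuit p) : 0 < Γ.size := Nat.zero_lt_of_lt Γ.out₁.isLt

theorem steps_setup (Γ : DCircuit p) (ω : ℕ → Bool) {B : ℕ} (hB : 1 ≤ B) (K₀ : ℕ) :
    ∃ s, RProg.Steps (.setup h B K₀) (RState.init Γ.encode ω) s
        (Γ.size * 6 + (8 * (B * Γ.logSize)) ^ (h - 1) + (2 * h + B + 19)) ∧ Γ.Ready s ∧
      s.reg 21 = Γ.encode.length + h * Γ.out₁ ∧ s.reg 22 = Γ.encode.length + h * Γ.out₂ ∧
      s.reg 4 = Γ.size + K₀ ∧ s.reg 6 = 2 ^ ((B * Γ.logSize) ^ (h - 1) + 1) ∧ s.reg 7 = 0 ∧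
      s.coins = ω := by
  set s₀ := RState.init Γ.encode ω with hs₀
  set c₁ : RProg := .block [.const 1 1, .add 2 0 23, .load 3 23, .load 14 1, .const 18 2,
    .load 15 18, .add 21 2 23, .add 22 2 23] with hc₁
  have hc₁s : c₁.Straight := by simp [hc₁, RProg.block, RProg.Straight]
  set s₁ := c₁.run s₀ with hs₁
  have e₂ := RProg.steps_iter_add (r := 21) (a := 14) (by decide) h s₁
  set s₂ := s₁.set 21 (s₁.reg 21 + h * s₁.reg 14) with hs₂
  have e₃ := RProg.steps_iter_add (r := 22) (a := 15) (by decide) h s₂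
  set s₃ := s₂.set 22 (s₂.reg 22 + h * s₂.reg 15) with hs₃
  set c₄ : RProg := .block [.const 4 K₀, .add 4 4 3, .const 5 1, .const 18 1, .add 10 3 23]
    with hc₄
  have hc₄s : c₄.Straight := by simp [hc₄, RProg.block, RProg.Straight]
  set s₄ := c₄.run s₃ with hs₄
  have m0 : s₀.mem 0 = Γ.size := by simp [hs₀, RState.init, encode]
  have m1 : s₀.mem 1 = Γ.out₁ := by simp [hs₀, RState.init, encode]
  have m2 : s₀.mem 2 = Γ.out₂ := by simp [hs₀, RState.init, encode]
  have i0 : s₀.reg 0 = Γ.encode.length := by simp [hs₀, RState.init]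
  have i7 : s₀.reg 7 = 0 := by simp [hs₀, RState.init]
  have i23 : s₀.reg 23 = 0 := by simp [hs₀, RState.init]
  have g1 : s₄.reg 1 = 1 := by
    simp [hs₄, hs₃, hs₂, hs₁, hc₁, hc₄, RProg.block, RProg.run, RState.set]
  have g2 : s₄.reg 2 = Γ.encode.length := by
    simp [hs₄, hs₃, hs₂, hs₁, hc₁, hc₄, RProg.block, RProg.run, RState.set, i0, i23]
  have g3 : s₄.reg 3 = Γ.size := by
    simp [hs₄, hs₃, hs₂, hs₁, hc₁, hc₄, RProg.block, RProg.run, RState.set, i23, m0]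
  have g4 : s₄.reg 4 = Γ.size + K₀ := by
    simp [hs₄, hs₃, hs₂, hs₁, hc₁, hc₄, RProg.block, RProg.run, RState.set, i23, m0, add_comm]
  have g5 : s₄.reg 5 = 1 := by
    simp [hs₄, hs₃, hs₂, hs₁, hc₁, hc₄, RProg.block, RProg.run, RState.set]
  have g7 : s₄.reg 7 = 0 := by
    simp [hs₄, hs₃, hs₂, hs₁, hc₁, hc₄, RProg.block, RProg.run, RState.set, i7]
  have g10 : s₄.reg 10 = Γ.size := by
    simp [hs₄, hs₃, hs₂, hs₁, hc₁, hc₄, RProg.block, RProg.run, RState.set, i23, m0]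
  have g18 : s₄.reg 18 = 1 := by
    simp [hs₄, hs₃, hs₂, hs₁, hc₁, hc₄, RProg.block, RProg.run, RState.set]
  have g21 : s₄.reg 21 = Γ.encode.length + h * Γ.out₁ := by
    simp [hs₄, hs₃, hs₂, hs₁, hc₁, hc₄, RProg.block, RProg.run, RState.set, i0, i23, m1]
  have g22 : s₄.reg 22 = Γ.encode.length + h * Γ.out₂ := by
    simp [hs₄, hs₃, hs₂, hs₁, hc₁, hc₄, RProg.block, RProg.run, RState.set, i0, i23, m2]
  have g23 : s₄.reg 23 = 0 := by
    simp [hs₄, hs₃, hs₂, hs₁, hc₁, hc₄, RProg.block, RProg.run, RState.set, i23]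
  have gm : s₄.mem = s₀.mem := by
    simp [hs₄, hs₃, hs₂, hs₁, hc₁, hc₄, RProg.block, RProg.run, RState.set]
  have gc : s₄.coins = s₀.coins := by
    simp [hs₄, hs₃, hs₂, hs₁, hc₁, hc₄, RProg.block, RProg.run, RState.set]
  obtain ⟨s₅, e₅, l5, lm, lc, lr⟩ := RProg.steps_logLoop s₄ g1 g5 g18
    (by rw [g10, g3])
  rw [g3] at e₅ l5
  have e₆ := RProg.Straight.steps (c := .const 29 0) trivial s₅
  set s₆ := (RProg.const 29 0).run s₅ with hs₆
  have e₇ := RProg.steps_iter_add (r := 29) (a := 5) (by decide) B s₆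
  set s₇ := s₆.set 29 (s₆.reg 29 + B * s₆.reg 5) with hs₇
  have e₈ := RProg.Straight.steps (c := .const 6 2) trivial s₇
  set s₈ := (RProg.const 6 2).run s₇ with hs₈
  have f : ∀ r, r ≠ 5 → r ≠ 6 → r ≠ 10 → r ≠ 18 → r ≠ 19 → r ≠ 29 → s₈.reg r = s₄.reg r := by
    intro r r1 r2 r3 r4 r5 r6
    rw [← lr r r1 r3 r4 r5]
    simp [hs₈, hs₇, hs₆, RProg.run, RState.set, r2, r6]
  have f29 : s₈.reg 29 = B * Γ.logSize := by
    simp [hs₈, hs₇, hs₆, RProg.run, RState.set, l5, logSize]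
  have f6 : s₈.reg 6 = 2 := by simp [hs₈, RProg.run, RState.set]
  have fm : s₈.mem = s₀.mem := by
    rw [← gm, ← lm]; simp [hs₈, hs₇, hs₆, RProg.run, RState.set]
  have fc : s₈.coins = s₀.coins := by
    rw [← gc, ← lc]; simp [hs₈, hs₇, hs₆, RProg.run, RState.set]
  obtain ⟨s₉, e₉, q6, qm, qc, qr⟩ := RProg.steps_powLoop (h - 1) s₈
    (by rw [f 1, g1] <;> omega) (by rw [f 23, g23] <;> omega)
    (by rw [f29]; exact Nat.mul_pos hB (Nat.succ_pos _))
  rw [f29] at e₉ q6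
  have fr : ∀ r, r ≠ 5 → r ≠ 6 → r ≠ 10 → r ≠ 18 → r ≠ 19 → r < 29 → s₉.reg r = s₄.reg r := by
    intro r r1 r2 r3 r4 r5 r6
    rw [qr r r2 (by omega), f r r1 r2 r3 r4 r5 (by omega)]
  refine ⟨s₉, ((hc₁s.steps s₀).seq (e₂.seq (e₃.seq ((hc₄s.steps s₃).seq (e₅.seq (e₆.seq (e₇.seq
    (e₈.seq e₉)))))))).mono ?_, ⟨?_, ?_, ?_, ?_, ?_⟩, ?_, ?_, ?_, ?_, ?_, ?_⟩
  · have t1 : c₁.cost = 8 := by simp [hc₁, RProg.block, RProg.cost]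
    have t2 : c₄.cost = 5 := by simp [hc₄, RProg.block, RProg.cost]
    have t3 : (RProg.const 29 0).cost = 1 := rfl
    have t4 : (RProg.const 6 2).cost = 1 := rfl
    rw [t1, t2, t3, t4]
    omega
  · rw [fr 1, g1] <;> omega
  · rw [fr 23, g23] <;> omega
  · rw [fr 2, g2] <;> omega
  · rw [fr 3, g3] <;> omega
  · intro z _
    rw [qm, fm]; rfl
  · rw [fr 21, g21] <;> omega
  · rw [fr 22, g22] <;> omega
  · rw [fr 4, g4] <;> omega
  · rw [q6, f6, pow_succ]; ring
  · rw [fr 7, g7] <;> omega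
  · rw [qc, fc]; rfl

-- The answer `b.not.toNat` is returned only after a trial has exhibited a witness: equal outputs
-- for `b = false` (satisfiability), different ones for `b = true` (inequivalence).
open Classical in
theorem steps_search (hp : ∀ i, 1 < p i) (Γ : DCircuit p) (b : Bool) (ω : ℕ → Bool) {B : ℕ}
    (hB : 1 ≤ B) (K₀ : ℕ) :
    ∃ s, RProg.Steps (.search p b B K₀) (RState.init Γ.encode ω) s
        (Γ.size * 6 + (8 * (B * Γ.logSize)) ^ (h - 1) + (2 * h + B + 21) +
          2 ^ ((B * Γ.logSize) ^ (h - 1) + 1) *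
            (Γ.size * (h * ((Γ.size + K₀) * 10 + 42) + 14) + h * 9 + 11)) ∧
      s.reg 0 = if (∃ i < 2 ^ ((B * Γ.logSize) ^ (h - 1) + 1),
        Γ.TrialSucceeds b (Γ.size + K₀) fun z => ω (i * (Γ.size * h * (Γ.size + K₀)) + z))
        then b.not.toNat else b.toNat := by
  obtain ⟨s₁, e₁, hR, h21, h22, h4, h6, h7, hc⟩ := Γ.steps_setup ω hB K₀
  set N := 2 ^ ((B * Γ.logSize) ^ (h - 1) + 1) with hN
  set K := Γ.size + K₀ with hK
  obtain ⟨s₂, e₂, hs⟩ := RProg.Steps.loop (r := 6) (c := .trial p b)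
    (T := Γ.size * (h * (K * 10 + 42) + 14) + h * 9 + 10)
    (fun n s => s.reg 6 = n ∧ ∃ m, m + n = N ∧ Γ.Ready s ∧
      s.reg 21 = Γ.encode.length + h * Γ.out₁ ∧ s.reg 22 = Γ.encode.length + h * Γ.out₂ ∧
      s.reg 4 = K ∧ (∀ z, s.coins z = ω (m * (Γ.size * h * K) + z)) ∧
      s.reg 7 = if ∃ i < m, Γ.TrialSucceeds b K fun z => ω (i * (Γ.size * h * K) + z)
        then 1 else 0)
    (fun n s hs => hs.1)
    (by
      rintro n s ⟨a6, m, hm, aR, a21, a22, a4, ac, a7⟩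
      obtain ⟨s', hs', bR, bf, b6, b7, bc⟩ := Γ.steps_trial hp b aR a21 a22
      rw [a4] at hs' b7 bc
      refine ⟨s', hs', by omega, m + 1, by omega, bR, by rw [bf 21 (by omega), a21],
        by rw [bf 22 (by omega), a22], by rw [bf 4 (by omega), a4], fun z => ?_, ?_⟩
      · rw [bc, ac]; congr 1; ring
      · have hcoins : s.coins = fun z => ω (m * (Γ.size * h * K) + z) := funext ac
        rw [b7, a7, hcoins]
        simp only [Nat.lt_succ_iff_lt_or_eq, or_and_right, exists_or, exists_eq_left]
        by_cases t1 : Γ.TrialSucceeds b K fun z => ω (m * (Γ.size * h * K) + z)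
        · rw [if_pos t1, if_pos (Or.inr t1)]
        · rw [if_neg t1]
          exact if_congr (or_iff_left t1).symm rfl rfl)
    N s₁ ⟨h6, 0, by omega, hR, h21, h22, h4, fun z => by rw [hc, Nat.zero_mul, Nat.zero_add],
      by rw [h7]; simp⟩
  obtain ⟨-, m, hm, aR, -, -, -, -, a7⟩ := hs
  obtain rfl : m = N := by omega
  have e₃ : RProg.Steps (if b then .sub 0 1 7 else .add 0 7 23) s₂
      ((if b then RProg.sub 0 1 7 else .add 0 7 23).run s₂) 1 := by
    cases b
    · exact RProg.Straight.steps (c := .add 0 7 23) trivial s₂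
    · exact RProg.Straight.steps (c := .sub 0 1 7) trivial s₂
  refine ⟨_, (e₁.seq (e₂.seq e₃)).mono ?_, ?_⟩
  · have : Γ.size * (h * (K * 10 + 42) + 14) + h * 9 + 10 + 1
      = Γ.size * (h * (K * 10 + 42) + 14) + h * 9 + 11 := rfl
    rw [this]
    omega
  · cases b
    · simp [RProg.run, RState.set, a7, aR.zero]
    · simp [RProg.run, RState.set, a7, aR.one]
      split_ifs <;> rfl

end DCircuit

/-! ### Counting outcomes of coin tosses -/

/-- Events that depend on finitely many coins. -/
theorem coinLaw_comp_mem {ι : Type*} [Fintype ι] [DecidableEq ι] {e : ι → ℕ}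
    (he : Function.Injective e) (E : Finset (ι → Bool)) :
    coinLaw {ω | (fun i => ω (e i)) ∈ E} = E.card / 2 ^ Fintype.card ι := by
  have hsingle : ∀ f : ι → Bool,
      coinLaw {ω | (fun i => ω (e i)) = f} = (2 ^ Fintype.card ι)⁻¹ := by
    intro f
    -- A cylinder over the range of `e`; the value `false` off the range plays no role.
    have hset : {ω : ℕ → Bool | (fun i => ω (e i)) = f}
        = Set.pi (Finset.univ.image e : Finset ℕ)
          (fun n => {Function.extend e f (fun _ => false) n}) := by
      ext ω
      simp [Set.mem_pi, funext_iff, he.extend_apply]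
    rw [hset, coinLaw, MeasureTheory.Measure.infinitePi_pi _ (fun _ _ => MeasurableSet.of_discrete)]
    simp only [PMF.toMeasure_apply_singleton _ _ (MeasurableSet.singleton _),
      PMF.uniformOfFintype_apply, Fintype.card_bool, Finset.prod_const,
      Finset.card_image_of_injective _ he, Finset.card_univ]
    rw [ENNReal.inv_pow]; norm_num
  have hmeas : Measurable fun (ω : ℕ → Bool) i => ω (e i) := by fun_prop
  have hunion : {ω : ℕ → Bool | (fun i => ω (e i)) ∈ E}
      = ⋃ f ∈ E, {ω | (fun i => ω (e i)) = f} := by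
    ext ω; simp
  rw [hunion, MeasureTheory.measure_biUnion_finset]
  · simp only [hsingle, Finset.sum_const, nsmul_eq_mul, div_eq_mul_inv]
  · intro f _ g _ hfg
    exact Set.disjoint_left.mpr fun ω h1 h2 => hfg (h1.symm.trans h2)
  · intro f _
    exact hmeas (MeasurableSet.singleton f)

theorem binNum_congr {f g : ℕ → Bool} {K : ℕ} (h : ∀ t < K, f t = g t) :
    binNum f K = binNum g K := by
  induction K with
  | zero => rfl
  | succ K ih => rw [binNum, binNum, ih fun t ht => h t (by omega), h K (by omega)]

theorem exists_binNum_eq (K n : ℕ) (hn : n < 2 ^ K) : ∃ f : ℕ → Bool, binNum f K = n := by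
  induction K generalizing n with
  | zero => exact ⟨fun _ => false, by simp [binNum] at hn ⊢; omega⟩
  | succ K ih =>
    obtain ⟨f, hf⟩ := ih (n / 2) (by rw [pow_succ] at hn; omega)
    refine ⟨Function.update f K (decide (n % 2 = 1)), ?_⟩
    have : binNum (Function.update f K (decide (n % 2 = 1))) K = n / 2 := by
      rw [← hf]
      exact binNum_congr fun t ht => Function.update_of_ne (by omega) _ _
    rw [binNum, this]
    simp only [Function.update_self, decide_eq_true_eq]
    split_ifs <;> omega

/-- A finite sequence of coins as an infinite one. -/
def padFalse {K : ℕ} (f : Fin K → Bool) : ℕ → Bool := fun t => if ht : t < K then f ⟨t, ht⟩ else false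

/-- All the numbers `v.val + q * i` with `i < 2 ^ K / q` lie below `2 ^ K`, and distinct numbers
have distinct digits. -/
theorem le_card_binNum_eq {q : ℕ} (hq : 0 < q) (K : ℕ) (v : ZMod q) :
    2 ^ K / q ≤ (Finset.univ.filter fun f : Fin K → Bool =>
      (binNum (padFalse f) K : ZMod q) = v).card := by
  have : NeZero q := ⟨hq.ne'⟩
  have hlt : ∀ i : Fin (2 ^ K / q), v.val + q * i < 2 ^ K := by
    intro i
    have h1 := ZMod.val_lt v
    have h2 := Nat.mul_le_mul_left q (Nat.succ_le_of_lt i.isLt)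
    have h3 := Nat.mul_div_le (2 ^ K) q
    rw [Nat.mul_succ] at h2
    omega
  choose f hf using fun i => exists_binNum_eq K _ (hlt i)
  let g : Fin (2 ^ K / q) → Fin K → Bool := fun i t => f i t
  have hg : ∀ i, binNum (padFalse (g i)) K = v.val + q * i := fun i => by
    rw [← hf]
    exact binNum_congr fun t ht => by simp [padFalse, g, ht]
  have hinj : Function.Injective g := by
    intro i j hij
    have := hg j
    rw [← hij, hg i, Nat.add_left_cancel_iff] at this
    exact Fin.ext (Nat.eq_of_mul_eq_mul_left hq this)
  calc 2 ^ K / q = (Finset.univ.image g).card := by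
        rw [Finset.card_image_of_injective _ hinj, Finset.card_univ, Fintype.card_fin]
    _ ≤ _ := by
        refine Finset.card_le_card fun a ha => ?_
        obtain ⟨i, -, rfl⟩ := Finset.mem_image.mp ha
        rw [Finset.mem_filter, hg]
        simp

/-! ### Success probability of random sampling -/

namespace DCircuit

variable {h : ℕ} {p : Fin h → ℕ}

/-- The input sampled with the coins of one trial. -/
def sampleFin (Γ : DCircuit p) {K : ℕ} (g : Fin Γ.size × Fin h × Fin K → Bool) :
    Γ.Input → DAlg p :=
  fun k j => (binNum (padFalse fun t => g (k.val, j, t)) K : ZMod (p j))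

theorem sample_eq_sampleFin (Γ : DCircuit p) (K : ℕ) (ω : ℕ → Bool) :
    Γ.sample K ω = Γ.sampleFin fun a : Fin Γ.size × Fin h × Fin K =>
      ω ((a.1 * h + a.2.1) * K + a.2.2) := by
  funext k j
  rw [sample, sampleFin, binNum_congr]
  intro t ht
  simp [padFalse, ht]

-- A coordinate of an input gate takes a prescribed value with probability at least (1 - ε)/p_j with
-- ε = 1/(2 · size · h), since rounding 2^K/p_j down loses at most 1 and `hK` makes this a fraction
-- of at most ε. Coordinates of other gates are unconstrained. Over all size · h coordinates,
-- Bernoulli's inequality leaves a factor of at least 1/2.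
open Classical in
theorem le_card_sampleFin_eq (hp : ∀ i, 0 < p i) (Γ : DCircuit p) {K : ℕ}
    (hK : ∀ j, 2 * p j * (Γ.size * h) ≤ 2 ^ K) (x : Γ.Input → DAlg p) :
    (2 : ℝ) ^ (Γ.size * (h * K)) ≤ 2 * Nat.card (Γ.Input → DAlg p) *
      (Finset.univ.filter fun g : Fin Γ.size × Fin h × Fin K → Bool =>
        Γ.sampleFin g = x).card := by
  have (i : Fin h) : NeZero (p i) := ⟨(hp i).ne'⟩
  rcases Nat.eq_zero_or_pos h with rfl | hh
  · have h1 : (Finset.univ.filter fun g : Fin Γ.size × Fin 0 × Fin K → Bool =>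
        Γ.sampleFin g = x) = Finset.univ := by
      refine Finset.filter_true_of_mem fun g _ => ?_
      funext k j; exact j.elim0
    rw [h1]
    simp
  let A : Fin Γ.size × Fin h → Finset (Fin K → Bool) := fun a =>
    Finset.univ.filter fun f => ∀ hk : Γ.gate a.1 = .input,
      (binNum (padFalse f) K : ZMod (p a.2)) = x ⟨a.1, hk⟩ a.2
  have hcard : (Finset.univ.filter fun g : Fin Γ.size × Fin h × Fin K → Bool =>
      Γ.sampleFin g = x).card = ∏ a, (A a).card := by
    rw [← Fintype.card_piFinset]
    refine Finset.card_bij' (fun g _ a t => g (a.1, a.2, t)) (fun f _ b => f (b.1, b.2.1) b.2.2)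
      ?_ ?_ ?_ ?_
    · intro g hg
      rw [Finset.mem_filter] at hg
      simp only [Fintype.mem_piFinset, A, Finset.mem_filter, Finset.mem_univ, true_and]
      rintro ⟨k, j⟩ hk
      rw [← hg.2]; rfl
    · intro f hf
      simp only [Fintype.mem_piFinset, A, Finset.mem_filter, Finset.mem_univ, true_and] at hf
      rw [Finset.mem_filter]
      refine ⟨Finset.mem_univ _, ?_⟩
      funext k j
      exact hf (k.val, j) k.2
    · intro g _; rfl
    · intro f _; rfl
  set S : ℝ := Γ.size * h with hS
  have hS1 : 1 ≤ S := by
    have h1 : (1 : ℝ) ≤ Γ.size := by exact_mod_cast Γ.size_pos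
    have h2 : (1 : ℝ) ≤ h := by exact_mod_cast hh
    nlinarith
  set ε : ℝ := 1 / (2 * S) with hε
  let w : Fin Γ.size × Fin h → ℝ := fun a => if Γ.gate a.1 = .input then ((p a.2 : ℝ))⁻¹ else 1
  have hε1 : ε ≤ 1 / 2 := by
    rw [hε]; exact one_div_le_one_div_of_le two_pos (by linarith)
  have hε0 : 0 ≤ ε := by positivity
  have hA : ∀ a, (2 : ℝ) ^ K * w a * (1 - ε) ≤ (A a).card := by
    rintro ⟨k, j⟩
    by_cases hk : Γ.gate k = .input
    · have h1 := le_card_binNum_eq (hp j) K (x ⟨k, hk⟩ j)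
      have h2 : A (k, j) = Finset.univ.filter fun f : Fin K → Bool =>
          (binNum (padFalse f) K : ZMod (p j)) = x ⟨k, hk⟩ j := by
        ext f; simp [A, hk]
      rw [← h2] at h1
      have h3 : (2 : ℝ) ^ K / p j - 1 ≤ (A (k, j)).card := by
        have h4 : (2 : ℝ) ^ K / p j < ((2 ^ K / p j : ℕ) : ℝ) + 1 := by
          have := Nat.lt_floor_add_one ((2 : ℝ) ^ K / p j)
          rw [show (2 : ℝ) ^ K = ((2 ^ K : ℕ) : ℝ) by push_cast; rfl] at this ⊢
          rwa [Nat.floor_div_eq_div] at this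
        have h5 : ((2 ^ K / p j : ℕ) : ℝ) ≤ (A (k, j)).card := by exact_mod_cast h1
        linarith
      refine le_trans ?_ h3
      have hpj : (0 : ℝ) < p j := by exact_mod_cast hp j
      have h6 : 1 ≤ (2 : ℝ) ^ K / p j * ε := by
        rw [hε, div_mul_div_comm, mul_one, le_div_iff₀ (by positivity), one_mul]
        have h7 : ((2 * p j * (Γ.size * h) : ℕ) : ℝ) ≤ ((2 ^ K : ℕ) : ℝ) := by
          exact_mod_cast hK j
        push_cast at h7
        rw [hS]; linarith
      simp only [w, if_pos hk]
      rw [← div_eq_mul_inv]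
      linarith
    · have h2 : A (k, j) = Finset.univ := by
        ext f; simp [A, hk]
      rw [h2]
      simp only [w, if_neg hk, Finset.card_univ, Fintype.card_pi, Fintype.card_bool,
        Finset.prod_const, Fintype.card_fin]
      push_cast
      have : (0 : ℝ) < 2 ^ K := by positivity
      nlinarith
  have hw0 : ∀ a, 0 ≤ w a := fun a => by
    simp only [w]; split_ifs <;> positivity
  have hprod : ∏ a, ((2 : ℝ) ^ K * w a * (1 - ε)) ≤ ∏ a, ((A a).card : ℝ) :=
    Finset.prod_le_prod (fun a _ => mul_nonneg (mul_nonneg (by positivity) (hw0 a))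
      (by linarith)) fun a _ => hA a
  have hwprod : ∏ a, w a = (Nat.card (Γ.Input → DAlg p) : ℝ)⁻¹ := by
    rw [Fintype.prod_prod_type]
    have h1 : ∀ k : Fin Γ.size, ∏ j, w (k, j)
        = if Γ.gate k = .input then ((∏ j, p j : ℕ) : ℝ)⁻¹ else 1 := by
      intro k
      simp only [w]
      split_ifs with hk
      · push_cast; rw [Finset.prod_inv_distrib]
      · simp
    simp only [h1, Finset.prod_ite, Finset.prod_const, one_pow, mul_one]
    rw [Nat.card_eq_fintype_card, Fintype.card_fun, Fintype.card_subtype, Fintype.card_pi]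
    simp [ZMod.card]
  have hbern : (1 : ℝ) / 2 ≤ (1 - ε) ^ (Γ.size * h) := by
    have := one_add_mul_le_pow (a := -ε) (by linarith) (Γ.size * h)
    have h2 : ((Γ.size * h : ℕ) : ℝ) * -ε = -(1 / 2) := by
      push_cast
      rw [hε, ← hS]
      field_simp
    rw [h2] at this
    calc (1 : ℝ) / 2 = 1 + -(1 / 2) := by norm_num
      _ ≤ (1 + -ε) ^ (Γ.size * h) := this
      _ = _ := by rw [← sub_eq_add_neg]
  rw [hcard]
  push_cast
  rw [Finset.prod_mul_distrib, Finset.prod_mul_distrib, hwprod] at hprod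
  simp only [Finset.prod_const, Finset.card_univ, Fintype.card_prod, Fintype.card_fin] at hprod
  have hC : (0 : ℝ) < Nat.card (Γ.Input → DAlg p) := by exact_mod_cast Nat.card_pos
  have hpow : ((2 : ℝ) ^ K) ^ (Γ.size * h) = 2 ^ (Γ.size * (h * K)) := by
    rw [← pow_mul]; congr 1; ring
  rw [hpow] at hprod
  calc (2 : ℝ) ^ (Γ.size * (h * K))
      = 2 * Nat.card (Γ.Input → DAlg p) * (2 ^ (Γ.size * (h * K)) *
          (Nat.card (Γ.Input → DAlg p) : ℝ)⁻¹ * (1 / 2)) := by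
        field_simp
    _ ≤ 2 * Nat.card (Γ.Input → DAlg p) * (2 ^ (Γ.size * (h * K)) *
          (Nat.card (Γ.Input → DAlg p) : ℝ)⁻¹ * (1 - ε) ^ (Γ.size * h)) := by
        gcongr
    _ ≤ _ := by gcongr

open Classical in
/-- A set of inputs of density at least `2 ^ (-M)` is hit by sampling. -/
theorem le_card_sampleFin_mem (hp : ∀ i, 0 < p i) (Γ : DCircuit p) {K M : ℕ}
    (hK : ∀ j, 2 * p j * (Γ.size * h) ≤ 2 ^ K) (U : Set (Γ.Input → DAlg p))
    (hU : Nat.card (Γ.Input → DAlg p) ≤ 2 ^ M * Nat.card U) :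
    2 ^ (Γ.size * (h * K)) ≤ 2 ^ (M + 1) *
      (Finset.univ.filter fun g : Fin Γ.size × Fin h × Fin K → Bool => Γ.sampleFin g ∈ U).card := by
  have (i : Fin h) : NeZero (p i) := ⟨(hp i).ne'⟩
  have hsum : (Finset.univ.filter fun g : Fin Γ.size × Fin h × Fin K → Bool =>
      Γ.sampleFin g ∈ U).card = ∑ x ∈ U.toFinset, (Finset.univ.filter
        fun g : Fin Γ.size × Fin h × Fin K → Bool => Γ.sampleFin g = x).card := by
    rw [Finset.card_eq_sum_card_fiberwise (f := Γ.sampleFin) (t := U.toFinset)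
      (fun g hg => by simpa using hg)]
    refine Finset.sum_congr rfl fun x hx => ?_
    congr 1
    ext g
    simp only [Finset.mem_filter, Finset.mem_univ, true_and, and_iff_right_iff_imp]
    rintro rfl
    simpa using hx
  have hC : (0 : ℝ) < Nat.card (Γ.Input → DAlg p) := by exact_mod_cast Nat.card_pos
  have h1 : (Nat.card U : ℝ) * 2 ^ (Γ.size * (h * K)) ≤ 2 * Nat.card (Γ.Input → DAlg p) *
      (Finset.univ.filter fun g : Fin Γ.size × Fin h × Fin K → Bool =>
        Γ.sampleFin g ∈ U).card := by
    rw [hsum]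
    push_cast
    rw [Finset.mul_sum, Nat.card_eq_card_toFinset, ← nsmul_eq_mul, ← Finset.sum_const]
    exact Finset.sum_le_sum fun x _ => Γ.le_card_sampleFin_eq hp hK x
  have h2 : (Nat.card (Γ.Input → DAlg p) : ℝ) ≤ 2 ^ M * Nat.card U := by exact_mod_cast hU
  have h3 : (2 : ℝ) ^ (Γ.size * (h * K)) ≤ 2 ^ (M + 1) *
      (Finset.univ.filter fun g : Fin Γ.size × Fin h × Fin K → Bool =>
        Γ.sampleFin g ∈ U).card := by
    refine le_of_mul_le_mul_left ?_ hC
    calc (Nat.card (Γ.Input → DAlg p) : ℝ) * 2 ^ (Γ.size * (h * K))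
        ≤ 2 ^ M * Nat.card U * 2 ^ (Γ.size * (h * K)) := by gcongr
      _ = 2 ^ M * (Nat.card U * 2 ^ (Γ.size * (h * K))) := by ring
      _ ≤ 2 ^ M * (2 * Nat.card (Γ.Input → DAlg p) * _) := by gcongr
      _ = _ := by rw [pow_succ]; ring
  exact_mod_cast h3

/-- Among `2 ^ (M + 1)` independent trials, one is likely to hit a set of density `2 ^ (-M)`. -/
theorem half_le_coinLaw_exists_sample_mem (hp : ∀ i, 0 < p i) (Γ : DCircuit p) {K M : ℕ}
    (hK : ∀ j, 2 * p j * (Γ.size * h) ≤ 2 ^ K) (U : Set (Γ.Input → DAlg p))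
    (hU : Nat.card (Γ.Input → DAlg p) ≤ 2 ^ M * Nat.card U) :
    1 / 2 ≤ coinLaw {ω | ∃ i < 2 ^ (M + 1),
      Γ.sample K (fun z => ω (i * (Γ.size * h * K) + z)) ∈ U} := by
  classical
  set N := 2 ^ (M + 1) with hN
  let κ := Fin Γ.size × Fin h × Fin K
  -- The position of a coin in the infinite sequence; injectivity makes the trials independent.
  let e : Fin N × κ → ℕ := fun a =>
    a.1 * (Γ.size * h * K) + ((a.2.1 * h + a.2.2.1) * K + a.2.2.2)
  have he : Function.Injective e := by
    rintro ⟨i, k, j, t⟩ ⟨i', k', j', t'⟩ heq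
    have hlt : ∀ (k : Fin Γ.size) (j : Fin h) (t : Fin K),
        (k * h + j) * K + t < Γ.size * h * K := by
      intro k j t
      have h1 : k.val * h + j < Γ.size * h := by
        have := Nat.mul_le_mul_right h (Nat.succ_le_of_lt k.isLt)
        rw [Nat.succ_mul] at this
        omega
      have := Nat.mul_le_mul_right K (Nat.succ_le_of_lt h1)
      rw [Nat.succ_mul] at this
      omega
    obtain ⟨e1, e2⟩ := (mul_add_eq_mul_add_iff (hlt _ _ _) (hlt _ _ _)).mp heq
    obtain ⟨e3, e4⟩ := (mul_add_eq_mul_add_iff t.isLt t'.isLt).mp e2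
    obtain ⟨e5, e6⟩ := (mul_add_eq_mul_add_iff j.isLt j'.isLt).mp e3
    obtain rfl : i = i' := Fin.ext e1
    obtain rfl : k = k' := Fin.ext e5
    obtain rfl : j = j' := Fin.ext e6
    obtain rfl : t = t' := Fin.ext e4
    rfl
  let good : Finset (κ → Bool) := Finset.univ.filter fun g => Γ.sampleFin g ∈ U
  let E : Finset (Fin N × κ → Bool) := Finset.univ.filter fun g => ∃ i, (fun a => g (i, a)) ∈ good
  have hset : {ω : ℕ → Bool | ∃ i < N, Γ.sample K (fun z => ω (i * (Γ.size * h * K) + z)) ∈ U}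
      = {ω | (fun a => ω (e a)) ∈ E} := by
    ext ω
    simp only [Set.mem_ofPred_eq, E, good, Finset.mem_filter, Finset.mem_univ, true_and,
      sample_eq_sampleFin]
    exact ⟨fun ⟨i, hi, hm⟩ => ⟨⟨i, hi⟩, hm⟩, fun ⟨i, hm⟩ => ⟨i, i.isLt, hm⟩⟩
  have hbad : Eᶜ.card = goodᶜ.card ^ N := by
    have : goodᶜ.card ^ N = ∏ _i : Fin N, goodᶜ.card := by simp
    rw [this, ← Fintype.card_piFinset]
    refine Finset.card_bij' (fun g _ i a => g (i, a)) (fun f _ b => f b.1 b.2) ?_ ?_ ?_ ?_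
    · intro g hg
      simpa [E, Fintype.mem_piFinset] using hg
    · intro f hf
      simpa [E, Fintype.mem_piFinset] using hf
    · intro g _; rfl
    · intro f _; rfl
  have hκ : Fintype.card (κ → Bool) = 2 ^ (Γ.size * (h * K)) := by
    simp [κ]
  have hgood := Γ.le_card_sampleFin_mem hp hK U hU
  set Q := 2 ^ (Γ.size * (h * K)) with hQ
  have hQ0 : (0 : ℝ) < Q := by rw [hQ]; positivity
  have hbadQ : (goodᶜ.card : ℝ) = Q - good.card := by
    rw [Finset.card_compl, hκ, Nat.cast_sub]
    rw [← hκ]; exact Finset.card_le_univ _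
  -- A trial succeeds with probability at least 1/N, hence fails with probability at most exp(-1/N).
  -- All N trials fail with probability at most 1/e, which is below 1/2.
  have hle : (goodᶜ.card : ℝ) ≤ Q * Real.exp (-(1 / N)) := by
    have h1 : (Q : ℝ) ≤ N * good.card := by exact_mod_cast hgood
    have hN0 : (0 : ℝ) < N := by rw [hN]; positivity
    have h2 : (Q : ℝ) * (1 / N) ≤ good.card := by
      rw [mul_one_div, div_le_iff₀ hN0]; linarith
    have h3 := Real.add_one_le_exp (-(1 / (N : ℝ)))
    rw [hbadQ]
    nlinarith
  have hpow : (Eᶜ.card : ℝ) ≤ Q ^ N * (1 / 2) := by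
    rw [hbad]
    push_cast
    calc (goodᶜ.card : ℝ) ^ N ≤ (Q * Real.exp (-(1 / N))) ^ N := by gcongr
      _ = Q ^ N * Real.exp (-1) := by
        rw [mul_pow, ← Real.exp_nat_mul]
        congr 2
        have hN0 : (N : ℝ) ≠ 0 := by rw [hN]; positivity
        field_simp
      _ ≤ Q ^ N * (1 / 2) := by
        gcongr
        rw [Real.exp_neg, one_div]
        have := Real.add_one_le_exp (1 : ℝ)
        exact inv_anti₀ two_pos (by linarith)
  have htot : Fintype.card (Fin N × κ → Bool) = Q ^ N := by
    simp [κ, hQ, ← pow_mul, mul_comm]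
  have hE : Q ^ N ≤ 2 * E.card := by
    have h1 : E.card + Eᶜ.card = Q ^ N := by rw [Finset.card_add_card_compl, htot]
    have h2 : ((E.card + Eᶜ.card : ℕ) : ℝ) = Q ^ N := by rw [h1]; push_cast; rfl
    push_cast at h2
    have h3 : ((Q ^ N : ℕ) : ℝ) ≤ ((2 * E.card : ℕ) : ℝ) := by push_cast; linarith
    exact_mod_cast h3
  rw [hset, coinLaw_comp_mem he]
  have h2pow : (2 : ENNReal) ^ Fintype.card (Fin N × κ) = ((Q ^ N : ℕ) : ENNReal) := by
    rw [← htot]; simp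
  rw [h2pow, ENNReal.le_div_iff_mul_le (Or.inl (by positivity)) (Or.inl (ENNReal.natCast_ne_top _)),
    one_div, mul_comm, ← div_eq_mul_inv]
  refine ENNReal.div_le_of_le_mul ?_
  rw [mul_comm]
  exact_mod_cast hE

end DCircuit

/-! ### The main theorem -/

/-- The number of trials is of the form allowed for the running time. -/
theorem exists_two_pow_clog_le (B e : ℕ) :
    ∃ c K : ℝ, 0 ≤ K ∧ ∀ n : ℕ, 1 ≤ n →
      (2 : ℝ) ^ (B * (Nat.clog 2 n + 1)) ^ e ≤ K * 2 ^ (c * Real.logb 2 n ^ e) := by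
  -- With ℓ = log₂ n, the inequality (ℓ + 2)^e ≤ 2^(e-1) (ℓ^e + 2^e) separates the logarithm from an
  -- additive constant, which moves into `K`.
  refine ⟨B ^ e * 2 ^ (e - 1), 2 ^ ((B : ℝ) ^ e * 2 ^ (e - 1) * 2 ^ e), by positivity,
    fun n hn => ?_⟩
  have hn' : (1 : ℝ) ≤ n := by exact_mod_cast hn
  have hℓ : 0 ≤ Real.logb 2 n := Real.logb_nonneg one_lt_two hn'
  have hclog : (Nat.clog 2 n : ℝ) ≤ Real.logb 2 n + 1 := by
    rcases Nat.lt_or_eq_of_le hn with h1 | rfl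
    · have h2 : 2 ^ (Nat.clog 2 n - 1) ≤ n := (Nat.pow_pred_clog_lt_self one_lt_two h1).le
      have h3 : ((Nat.clog 2 n - 1 : ℕ) : ℝ) ≤ Real.logb 2 n := by
        rw [Real.le_logb_iff_rpow_le one_lt_two (by linarith), Real.rpow_natCast]
        exact_mod_cast h2
      rw [Nat.cast_sub (Nat.clog_pos one_lt_two h1)] at h3
      push_cast at h3
      linarith
    · simp
  rw [← Real.rpow_natCast, ← Real.rpow_add two_pos]
  refine Real.rpow_le_rpow_of_exponent_le one_le_two ?_
  push_cast
  calc ((B : ℝ) * (Nat.clog 2 n + 1)) ^ e = (B : ℝ) ^ e * (Nat.clog 2 n + 1) ^ e := mul_pow _ _ _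
    _ ≤ (B : ℝ) ^ e * (Real.logb 2 n + 2) ^ e := by
        gcongr ?_ * ?_ ^ e
        linarith
    _ ≤ (B : ℝ) ^ e * (2 ^ (e - 1) * (Real.logb 2 n ^ e + 2 ^ e)) := by
        gcongr
        exact add_pow_le hℓ zero_le_two e
    _ = _ := by ring

/-! ### Running time and error of the search -/

namespace DCircuit

variable {h : ℕ} {p : Fin h → ℕ}

theorem size_le_two_pow_logSize (Γ : DCircuit p) : Γ.size ≤ 2 ^ Γ.logSize :=
  (Nat.le_pow_clog one_lt_two _).trans (Nat.pow_le_pow_right two_pos (Nat.le_succ _))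

/-- With X = 2^W, W = (B · logSize)^(h-1), the time is at most C X^3: one factor X comes from the
number of trials and two from a trial, which is quadratic in the size. The size is at most X because
h ≥ 2. Cubing merely triples the exponent. -/
theorem exists_search_time (hh : 2 ≤ h) {B : ℕ} (hB : 1 ≤ B) (K₀ : ℕ) :
    ∃ c K : ℝ, ∀ Γ : DCircuit p,
      ((Γ.size * 6 + (8 * (B * Γ.logSize)) ^ (h - 1) + (2 * h + B + 21) +
          2 ^ ((B * Γ.logSize) ^ (h - 1) + 1) *
            (Γ.size * (h * ((Γ.size + K₀) * 10 + 42) + 14) + h * 9 + 11) : ℕ) : ℝ)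
        ≤ K * (2 : ℝ) ^ (c * Real.logb 2 Γ.size ^ (h - 1)) := by
  obtain ⟨c, K, hK, hc⟩ := exists_two_pow_clog_le B (h - 1)
  set C := 6 + 8 ^ (h - 1) + (2 * h + B + 21) + 2 * (h * (10 + K₀ * 10 + 42) + 14 + h * 9 + 11)
    with hC
  refine ⟨3 * c, C * K ^ 3, fun Γ => ?_⟩
  have hX := hc Γ.size Γ.size_pos
  change (2 : ℝ) ^ (B * Γ.logSize) ^ (h - 1) ≤ _ at hX
  set W := (B * Γ.logSize) ^ (h - 1) with hW
  set X := 2 ^ W with hXdef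
  have hBL : 1 ≤ B * Γ.logSize := Nat.mul_pos hB (Nat.succ_pos _)
  have hX1 : 1 ≤ X := Nat.one_le_two_pow
  have hsX : Γ.size ≤ X := Γ.size_le_two_pow_logSize.trans (Nat.pow_le_pow_right two_pos
    ((Nat.le_mul_of_pos_left _ hB).trans (Nat.le_self_pow (by omega) _)))
  have hWX : W ≤ X := Nat.lt_two_pow_self.le
  have hX3 : X ≤ X ^ 3 := Nat.le_self_pow (by omega) _
  have hX13 : 1 ≤ X ^ 3 := Nat.one_le_pow _ _ hX1
  have hnat : Γ.size * 6 + (8 * (B * Γ.logSize)) ^ (h - 1) + (2 * h + B + 21) +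
      2 ^ (W + 1) * (Γ.size * (h * ((Γ.size + K₀) * 10 + 42) + 14) + h * 9 + 11) ≤ C * X ^ 3 := by
    have t1 : Γ.size * 6 ≤ 6 * X ^ 3 := by omega
    have t2 : (8 * (B * Γ.logSize)) ^ (h - 1) ≤ 8 ^ (h - 1) * X ^ 3 := by
      rw [mul_pow]; exact Nat.mul_le_mul_left _ (hWX.trans hX3)
    have t3 : 2 * h + B + 21 ≤ (2 * h + B + 21) * X ^ 3 := Nat.le_mul_of_pos_right _ hX13
    have t4 : Γ.size * (h * ((Γ.size + K₀) * 10 + 42) + 14) + h * 9 + 11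
        ≤ (h * (10 + K₀ * 10 + 42) + 14 + h * 9 + 11) * X ^ 2 := by
      have u1 : (Γ.size + K₀) * 10 + 42 ≤ (10 + K₀ * 10 + 42) * X := by
        have := Nat.mul_le_mul_left (K₀ * 10 + 42) hX1
        linarith
      have u2 : h * ((Γ.size + K₀) * 10 + 42) + 14 ≤ (h * (10 + K₀ * 10 + 42) + 14) * X := by
        have := Nat.mul_le_mul_left h u1
        linarith
      have u3 := Nat.mul_le_mul hsX u2
      have u4 : h * 9 + 11 ≤ (h * 9 + 11) * X ^ 2 :=
        Nat.le_mul_of_pos_right _ (Nat.pow_pos hX1)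
      calc _ ≤ X * ((h * (10 + K₀ * 10 + 42) + 14) * X) + (h * 9 + 11) * X ^ 2 := by linarith
        _ = _ := by ring
    have t5 := Nat.mul_le_mul_left (2 ^ (W + 1)) t4
    have t6 : 2 ^ (W + 1) * ((h * (10 + K₀ * 10 + 42) + 14 + h * 9 + 11) * X ^ 2)
        = 2 * (h * (10 + K₀ * 10 + 42) + 14 + h * 9 + 11) * X ^ 3 := by
      rw [pow_succ, ← hXdef]; ring
    refine (Nat.add_le_add (Nat.add_le_add (Nat.add_le_add t1 t2) t3) (t5.trans_eq t6)).trans_eq ?_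
    rw [hC]; ring
  calc _ ≤ ((C * X ^ 3 : ℕ) : ℝ) := by exact_mod_cast hnat
    _ = C * ((2 : ℝ) ^ W) ^ 3 := by rw [hXdef]; push_cast; rfl
    _ ≤ C * (K * 2 ^ (c * Real.logb 2 Γ.size ^ (h - 1))) ^ 3 := by gcongr
    _ = C * K ^ 3 * 2 ^ (3 * c * Real.logb 2 Γ.size ^ (h - 1)) := by
        rw [mul_pow, ← Real.rpow_natCast (2 ^ _), ← Real.rpow_mul zero_le_two, ← mul_assoc]
        congr 2
        push_cast; ring

/-- The algorithm finds solutions if they are dense. -/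
theorem half_le_coinLaw_search (hprime : ∀ i, (p i).Prime) (Γ : DCircuit p) (b : Bool) {B : ℕ}
    (hB : 1 ≤ B) {K₀ : ℕ} (hK₀ : ∀ j, 2 * h * p j ≤ K₀)
    (hU : Nat.card (Γ.Input → DAlg p) ≤ 2 ^ (B * Γ.logSize) ^ (h - 1) *
      Nat.card {x // (Γ.val x Γ.out₁ ≠ Γ.val x Γ.out₂) ↔ b = true}) :
    1 / 2 ≤ coinLaw {ω | (RProg.search p b B K₀).Returns Γ.encode ω b.not.toNat} := by
  have hK : ∀ j, 2 * p j * (Γ.size * h) ≤ 2 ^ (Γ.size + K₀) := fun j => by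
    have h1 : 2 * h * p j ≤ 2 ^ K₀ := (hK₀ j).trans Nat.lt_two_pow_self.le
    have h2 : Γ.size ≤ 2 ^ Γ.size := Nat.lt_two_pow_self.le
    rw [pow_add]
    calc 2 * p j * (Γ.size * h) = Γ.size * (2 * h * p j) := by ring
      _ ≤ _ := Nat.mul_le_mul h2 h1
  refine (Γ.half_le_coinLaw_exists_sample_mem (fun i => (hprime i).pos) hK
    {x | (Γ.val x Γ.out₁ ≠ Γ.val x Γ.out₂) ↔ b = true} hU).trans
    (MeasureTheory.measure_mono fun ω hω => ?_)
  obtain ⟨s, ⟨t, -, ht⟩, hs⟩ := Γ.steps_search (fun i => (hprime i).one_lt) b ω hB K₀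
  refine ⟨s, t, ht, ?_⟩
  rw [hs, if_pos]
  exact hω

/-- The algorithm finds nothing if there is nothing to be found. -/
theorem search_returns_of_forall (hprime : ∀ i, (p i).Prime) (Γ : DCircuit p) (b : Bool) {B : ℕ}
    (hB : 1 ≤ B) (K₀ : ℕ)
    (hΓ : ∀ x, ¬ ((Γ.val x Γ.out₁ ≠ Γ.val x Γ.out₂) ↔ b = true)) (ω : ℕ → Bool) :
    (RProg.search p b B K₀).Returns Γ.encode ω b.toNat := by
  obtain ⟨s, ⟨t, -, ht⟩, hs⟩ := Γ.steps_search (fun i => (hprime i).one_lt) b ω hB K₀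
  refine ⟨s, t, ht, ?_⟩
  rw [hs, if_neg]
  rintro ⟨i, -, hi⟩
  exact hΓ _ hi

end DCircuit

theorem theorem1p3 (sesh : SESH) (h : ℕ) (hh : 2 ≤ h) (p : Fin h → ℕ)
    (hprime : ∀ i, (p i).Prime)
    (halt : ∀ (i : ℕ) (hi : i + 1 < h), p ⟨i, Nat.lt_of_succ_lt hi⟩ ≠ p ⟨i + 1, hi⟩) :
    -- circuit satisfiability
    (∃ (c K : ℝ) (A : RProg), ∀ Γ : DCircuit p,
      A.RunsWithin Γ.encode (K * (2 : ℝ) ^ (c * Real.logb 2 Γ.size ^ (h - 1))) ∧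
      (Γ.Satisfiable → 1 / 2 ≤ coinLaw {ω | A.Returns Γ.encode ω 1}) ∧
      (¬ Γ.Satisfiable → ∀ ω, A.Returns Γ.encode ω 0)) ∧
    -- circuit equivalence
    (∃ (c K : ℝ) (A : RProg), ∀ Γ : DCircuit p,
      A.RunsWithin Γ.encode (K * (2 : ℝ) ^ (c * Real.logb 2 Γ.size ^ (h - 1))) ∧
      (Γ.Equivalent → ∀ ω, A.Returns Γ.encode ω 1) ∧
      (¬ Γ.Equivalent → 1 / 2 ≤ coinLaw {ω | A.Returns Γ.encode ω 0})) ∧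
    -- every value that is taken at all is taken on many tuples
    (∃ c K : ℝ, ∀ (Γ : DCircuit p) (k : Fin Γ.size) (d : DAlg p),
      (∃ x : Γ.Input → DAlg p, Γ.val x k = d) →
      (Nat.card (DAlg p) : ℝ) ^ Nat.card Γ.Input ≤
        K * (2 : ℝ) ^ (c * Real.logb 2 Γ.size ^ (h - 1)) *
          (Nat.card {x : Γ.Input → DAlg p // Γ.val x k = d} : ℝ)) := by
  have (i : Fin h) : NeZero (p i) := ⟨(hprime i).pos.ne'⟩
  obtain ⟨B, hB, hdens⟩ := DCircuit.exists_density_bound sesh hh hprime halt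
  have hK₀ : ∀ j, 2 * h * p j ≤ 2 * h * ∑ i, p i := fun j =>
    Nat.mul_le_mul_left _ (Finset.single_le_sum (f := p) (fun _ _ => Nat.zero_le _)
      (Finset.mem_univ j))
  set K₀ := 2 * h * ∑ i, p i
  obtain ⟨c, K, htime⟩ := DCircuit.exists_search_time (p := p) hh hB K₀
  have hruns : ∀ (b : Bool) (Γ : DCircuit p), (RProg.search p b B K₀).RunsWithin Γ.encode
      (K * (2 : ℝ) ^ (c * Real.logb 2 Γ.size ^ (h - 1))) := fun b Γ ω => by
    obtain ⟨s, ⟨t, hle, ht⟩, -⟩ := Γ.steps_search (fun i => (hprime i).one_lt) b ω hB K₀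
    exact ⟨s, t, ht, (Nat.cast_le.mpr hle).trans (htime Γ)⟩
  refine ⟨⟨c, K, RProg.search p false B K₀, fun Γ => ⟨hruns false Γ, fun ⟨x, hx⟩ => ?_,
    fun hΓ ω => ?_⟩⟩, ⟨c, K, RProg.search p true B K₀, fun Γ => ⟨hruns true Γ, fun hΓ ω => ?_,
    fun hΓ => ?_⟩⟩, ?_⟩
  · refine Γ.half_le_coinLaw_search hprime false hB hK₀ ?_
    refine (hdens Γ Γ.logSize (Nat.succ_pos _) Γ.size_le_two_pow_logSize _
      (Γ.isAffineInGates_sub_sub_const Γ.out₁ Γ.out₂ 0) ⟨x, by simp [hx]⟩).trans_eq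
      (congrArg _ (Nat.card_congr (Equiv.subtypeEquivRight fun x => ?_)))
    simp [sub_eq_zero]
  · exact Γ.search_returns_of_forall hprime false hB K₀ (fun x hx => hΓ ⟨x, by simpa using hx⟩) ω
  · exact Γ.search_returns_of_forall hprime true hB K₀ (fun x hx => hx.mpr rfl (hΓ x)) ω
  · refine Γ.half_le_coinLaw_search hprime true hB hK₀ ?_
    simp only [DCircuit.Equivalent, not_forall] at hΓ
    obtain ⟨x, hx⟩ := hΓ
    -- Inequality of the outputs is not an equation, but it follows from the equation that their
    -- difference equals the nonzero value attained at `x`; the solutions of the latter are already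
    -- dense.
    refine (hdens Γ Γ.logSize (Nat.succ_pos _) Γ.size_le_two_pow_logSize _
      (Γ.isAffineInGates_sub_sub_const Γ.out₁ Γ.out₂ (Γ.val x Γ.out₁ - Γ.val x Γ.out₂))
      ⟨x, by simp⟩).trans ?_
    refine Nat.mul_le_mul_left _ (Nat.card_le_card_of_injective
      (Subtype.map id fun y hy => ?_) (Subtype.map_injective _ Function.injective_id))
    refine iff_of_true (fun heq => hx ?_) rfl
    change Γ.val y Γ.out₁ = Γ.val y Γ.out₂ at heq
    rw [heq, sub_self, zero_sub, neg_eq_zero] at hy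
    exact sub_eq_zero.mp hy
  · obtain ⟨c, K, -, hc⟩ := exists_two_pow_clog_le B (h - 1)
    refine ⟨c, K, fun Γ k d ⟨x, hx⟩ => ?_⟩
    have h1 := hdens Γ Γ.logSize (Nat.succ_pos _) Γ.size_le_two_pow_logSize _
      (Γ.isAffineInGates_sub_const k d) ⟨x, by simp [hx]⟩
    simp only [sub_eq_zero] at h1
    rw [Nat.card_fun] at h1
    have h2 := hc Γ.size Γ.size_pos
    calc (Nat.card (DAlg p) : ℝ) ^ Nat.card Γ.Input
        ≤ 2 ^ (B * Γ.logSize) ^ (h - 1) * (Nat.card {x // Γ.val x k = d} : ℝ) := by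
          exact_mod_cast h1
      _ ≤ _ := mul_le_mul_of_nonneg_right h2 (Nat.cast_nonneg _)
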